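/- Let $X$ be a complex Banach space and let $S$ be a linear operator on $X$ with (not necessarily dense) domain $\mathcal D(S)\subset X$. Suppose $S$ is almost bisectorial: $i\mathbb R\setminus\{0\}\subset\varrho(S)$ and there are $0<\beta<1$ and $M$ with $\|(S-\lambda)^{-1}\|\le M|\lambda|^{-\beta}$ for all $\lambda\in i\mathbb R\setminus\{0\}$. Then there is $h>0$ such that $\{|\operatorname{Re}\lambda|\le h\}\subset\varrho(S)$ and $\sup_{|\operatorname{Re}\lambda|\le h}\|(S-\lambda)^{-1}\|<\infty$. For any such $h$ define the bounded operators $$A_\pm=\frac{\pm1}{2\pi i}\int_{\pm h-i\infty}^{\pm h+i\infty}\frac1{\lambda^2}(S-\lambda)^{-1}\,d\lambda$$ and the (possibly unbounded) operators $P_\pm=S^2A_\pm$ with domain $\mathcal D(P_\pm)=\{x\in X: A_\pm x\in\mathcal D(S^2)\}$. Then: (i) $\mathcal D(S)\subset\mathcal D(P_+)\cap\mathcal D(P_-)$ and, for every $x\in\mathcal D(S)$, the Cauchy principal value at infinity $\int_{-i\infty}^{i\infty\,\prime}(S-\lambda)^{-1}x\,d\lambda=\lim_{r\to\infty}\int_{-ir}^{ir}(S-\lambda)^{-1}x\,d\lambda$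 exists and $$2P_+x-x=P_+x-P_-x=\frac1{\pi i}\int_{-i\infty}^{i\infty\,\prime}(S-\lambda)^{-1}x\,d\lambda .$$ (ii) Suppose in addition that $S$ is densely defined and that there is a subspace $D\subset\mathcal D(S)$, dense in $\mathcal D(S)$ with respect to the norm of $X$, such that $x\mapsto\int_{-i\infty}^{i\infty\,\prime}(S-\lambda)^{-1}x\,d\lambda$, $x\in D$, defines a bounded operator $D\to X$. Then $P_+$ is a bounded operator with $\mathcal D(P_+)=X$, and $S$ is strictly dichotomous, i.e. $i\mathbb R\subset\varrho(S)$ and $X=X_+\oplus X_-$ with closed $S$-invariant subspaces $X_\pm$ such that $\sigma(S|X_+)\subset\{\operatorname{Re}\lambda>0\}$, $\sigma(S|X_-)\subset\{\operatorname{Re}\lambda<0\}$, $\|(S|X_+-\lambda)^{-1}\|$ is bounded on $\{\operatorname{Re}\lambda\le0\}$ and $\|(S|X_--\lambda)^{-1}\|$ is bounded on $\{\operatorname{Re}\lambda\ge0\}$. -/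

import Mathlib

open Filter Topology MeasureTheory

noncomputable section

namespace Dichotomy

variable {X : Type*} [NormedAddCommGroup X] [NormedSpace ℂ X]

/-- `R` is a bounded two-sided inverse of `S - l : D(S) → X`. -/
def IsResolventAt (S : X →ₗ.[ℂ] X) (l : ℂ) (R : X →L[ℂ] X) : Prop :=
  (∀ y : X, ∃ hy : R y ∈ S.domain, S ⟨R y, hy⟩ - l • R y = y) ∧
    ∀ x : S.domain, R (S x - l • (x : X)) = x

/-- The resolvent set of an unbounded operator. -/
def resolventSet (S : X →ₗ.[ℂ] X) : Set ℂ := {l | ∃ R : X →L[ℂ] X, IsResolventAt S l R}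

/-- The spectrum of an unbounded operator. -/
def spectrum (S : X →ₗ.[ℂ] X) : Set ℂ := (resolventSet S)ᶜ

open scoped Classical in
/-- The resolvent `(S - l)⁻¹` for `l` in the resolvent set (and `0` elsewhere). -/
def resolvent (S : X →ₗ.[ℂ] X) (l : ℂ) : X →L[ℂ] X :=
  if h : ∃ R : X →L[ℂ] X, IsResolventAt S l R then h.choose else 0

/-- The composition `T U` with its natural domain `{x ∈ D(U) | U x ∈ D(T)}`. -/
def opComp (T U : X →ₗ.[ℂ] X) : X →ₗ.[ℂ] X where
  domain :=
    { carrier := {x | ∃ hx : x ∈ U.domain, U ⟨x, hx⟩ ∈ T.domain}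
      add_mem' := by
        rintro a b ⟨ha, ha'⟩ ⟨hb, hb'⟩
        refine ⟨U.domain.add_mem ha hb, ?_⟩
        have h := U.map_add ⟨a, ha⟩ ⟨b, hb⟩
        exact h ▸ T.domain.add_mem ha' hb'
      zero_mem' := by
        refine ⟨U.domain.zero_mem, ?_⟩
        have h : U ⟨0, U.domain.zero_mem⟩ = 0 := U.map_zero
        rw [h]
        exact T.domain.zero_mem
      smul_mem' := by
        rintro c a ⟨ha, ha'⟩
        refine ⟨U.domain.smul_mem c ha, ?_⟩
        have h := U.map_smul c ⟨a, ha⟩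
        exact h ▸ T.domain.smul_mem c ha' }
  toFun :=
    { toFun := fun x => T ⟨U ⟨x.1, x.2.1⟩, x.2.2⟩
      map_add' := by
        intro a b
        rw [← T.map_add]
        congr 1
        exact Subtype.ext (U.map_add ⟨a.1, a.2.1⟩ ⟨b.1, b.2.1⟩)
      map_smul' := by
        intro c a
        rw [RingHom.id_apply, ← T.map_smul]
        congr 1
        exact Subtype.ext (U.map_smul c ⟨a.1, a.2.1⟩) }

/-- A bounded operator on all of `X`, regarded as an operator with domain `X`. -/
def ofBounded (A : X →L[ℂ] X) : X →ₗ.[ℂ] X := (A : X →ₗ[ℂ] X).toPMap ⊤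

/-- A subspace `U` is `S`-invariant: `S` maps `D(S) ∩ U` into `U`. -/
def IsInvariant (S : X →ₗ.[ℂ] X) (U : Submodule ℂ X) : Prop :=
  ∀ x : S.domain, (x : X) ∈ U → S x ∈ U

/-- The restriction `S|U` to an `S`-invariant subspace, an operator on `U` with domain
`D(S) ∩ U`. -/
def restrict (S : X →ₗ.[ℂ] X) (U : Submodule ℂ X) (hU : IsInvariant S U) : U →ₗ.[ℂ] U where
  domain := S.domain.comap U.subtype
  toFun :=
    { toFun := fun x => ⟨S ⟨x.1.1, x.2⟩, hU ⟨x.1.1, x.2⟩ x.1.2⟩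
      map_add' := fun a b => Subtype.ext (S.map_add ⟨a.1.1, a.2⟩ ⟨b.1.1, b.2⟩)
      map_smul' := fun c a => Subtype.ext (S.map_smul c ⟨a.1.1, a.2⟩) }

/-- `S` is strictly dichotomous with respect to `X = X₊ ⊕ X₋`. -/
structure StrictlyDichotomousWrt (S : X →ₗ.[ℂ] X) (Xp Xm : Submodule ℂ X) : Prop where
  isClosed_plus : IsClosed (Xp : Set X)
  isClosed_minus : IsClosed (Xm : Set X)
  isCompl : IsCompl Xp Xm
  imag_axis : ∀ l : ℂ, l.re = 0 → l ∈ resolventSet S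
  inv_plus : IsInvariant S Xp
  inv_minus : IsInvariant S Xm
  spec_plus : spectrum (restrict S Xp inv_plus) ⊆ {l | 0 < l.re}
  spec_minus : spectrum (restrict S Xm inv_minus) ⊆ {l | l.re < 0}
  bdd_plus : ∃ K : ℝ, ∀ l : ℂ, l.re ≤ 0 → ‖resolvent (restrict S Xp inv_plus) l‖ ≤ K
  bdd_minus : ∃ K : ℝ, ∀ l : ℂ, 0 ≤ l.re → ‖resolvent (restrict S Xm inv_minus) l‖ ≤ K

/-- `S` is strictly dichotomous (with respect to some decomposition). -/
def StrictlyDichotomous (S : X →ₗ.[ℂ] X) : Prop :=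
  ∃ Xp Xm : Submodule ℂ X, StrictlyDichotomousWrt S Xp Xm

/-- `S` is almost bisectorial. -/
def AlmostBisectorial (S : X →ₗ.[ℂ] X) : Prop :=
  (∀ l : ℂ, l.re = 0 → l ≠ 0 → l ∈ resolventSet S) ∧
    ∃ b : ℝ, 0 < b ∧ b < 1 ∧ ∃ M : ℝ,
      ∀ l : ℂ, l.re = 0 → l ≠ 0 → ‖resolvent S l‖ ≤ M / ‖l‖ ^ b

/-- The closed strip `|Re l| ≤ h`, `h > 0`, lies in the resolvent set and the resolvent is
uniformly bounded on it. -/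
def BoundedOnStrip (S : X →ₗ.[ℂ] X) (h : ℝ) : Prop :=
  0 < h ∧ (∀ l : ℂ, |l.re| ≤ h → l ∈ resolventSet S) ∧
    ∃ K : ℝ, ∀ l : ℂ, |l.re| ≤ h → ‖resolvent S l‖ ≤ K

/-- `(1 / 2πi) ∫ l⁻² (S - l)⁻¹ dl` along the upward vertical line `Re l = c`, `l = c + i t`,
`dl = i dt`; a Bochner integral in the operator norm. -/
def lineIntegral (S : X →ₗ.[ℂ] X) (c : ℝ) : X →L[ℂ] X :=
  (1 / (2 * (Real.pi : ℂ) * Complex.I)) •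
    ∫ t : ℝ, (Complex.I * (1 / ((c : ℂ) + (t : ℂ) * Complex.I) ^ 2)) •
      resolvent S ((c : ℂ) + (t : ℂ) * Complex.I)

/-- `A₊`, the line integral along `Re l = h`. -/
def APlus (S : X →ₗ.[ℂ] X) (h : ℝ) : X →L[ℂ] X := lineIntegral S h

/-- `A₋`, minus the line integral along `Re l = -h`. -/
def AMinus (S : X →ₗ.[ℂ] X) (h : ℝ) : X →L[ℂ] X := -lineIntegral S (-h)

/-- The (possibly unbounded) projection `P₊ = S² A₊`. -/
def PPlus (S : X →ₗ.[ℂ] X) (h : ℝ) : X →ₗ.[ℂ] X := opComp (opComp S S) (ofBounded (APlus S h))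

/-- The (possibly unbounded) projection `P₋ = S² A₋`. -/
def PMinus (S : X →ₗ.[ℂ] X) (h : ℝ) : X →ₗ.[ℂ] X := opComp (opComp S S) (ofBounded (AMinus S h))

/-- The integral of `f` over the imaginary axis (`l = i t`, `dl = i dt`) exists as a Cauchy
principal value at infinity and equals `v`. -/
def HasPVIntegral (f : ℂ → X) (v : X) : Prop :=
  (∀ r : ℝ, IntervalIntegrable (fun t : ℝ => Complex.I • f ((t : ℂ) * Complex.I)) volume (-r) r) ∧
    Tendsto (fun r : ℝ => ∫ t in (-r)..r, Complex.I • f ((t : ℂ) * Complex.I)) atTop (𝓝 v)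

end Dichotomy

end

noncomputable section

namespace Dichotomy

variable {X : Type*} [NormedAddCommGroup X] [NormedSpace ℂ X]

/-! ### Vertical lines and scalar integrals -/

/-! Write `R l` for $(S-l)^{-1}$. A Neumann series around $i\mathbb R$ gives the strip, and the
resolvent identity carries the decay to it: $\|R(l)\|\le C(1+|\operatorname{Im} l|)^{-b}$. This
decay makes $B=\frac1{2\pi i}\int_{\operatorname{Re} l=h} l^{-1}R(l)\,dl$ absolutely convergent, and
$R(0)B=A_+$. Hence $A_+R(0)=R(0)^2B$, that is, $P_+x=BSx$ on $\mathcal D(S)$. The same argument for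
$-S$ treats $P_-$.

For $x=R(0)y$ the resolvent identity gives $R(l)x=l^{-1}(R(l)y-x)$. Along $\operatorname{Re} l=h$
the principal value is therefore $2\pi i\,By-\pi i\,x$, since $1/l$ contributes $\pi i$. Cauchy's
theorem moves the line to $i\mathbb R$ (`tendsto_integral_imaginary_axis`). Comparison with $-S$
yields $P_+x+P_-x=x$ (`lineInt_sub_lineInt_reflect`), which proves (i).

In (ii) the formula of (i) defines a bounded $P$ with $R(0)^2P=A_+$, first on $D$ and then
everywhere by density, so $P_+=P$. Then $P$ commutes with the resolvent, and it is a projection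
because the integrals over the two lines annihilate each other (`lineInt_reflect_mul_lineInt`).
Finally $H(z)=\frac1{2\pi i}\int_{\operatorname{Re} l=h}(l-z)^{-1}R(l)\,dl$ is bounded uniformly on
$\operatorname{Re} z\le0$ and satisfies $(S-z)H(z)=P$, so it is the resolvent of $S$ on the range of
$P$; reflection handles the kernel. -/

/-- The point `c + i t`. -/
def vline (c t : ℝ) : ℂ := (c : ℂ) + (t : ℂ) * Complex.I

@[simp] lemma vline_re (c t : ℝ) : (vline c t).re = c := by simp [vline]

@[simp] lemma vline_im (c t : ℝ) : (vline c t).im = t := by simp [vline]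

lemma continuous_vline (c : ℝ) : Continuous (vline c) := by
  unfold vline; fun_prop

lemma vline_zero (t : ℝ) : vline 0 t = (t : ℂ) * Complex.I := by simp [vline]

lemma le_norm_vline_sub {h : ℝ} {z : ℂ} (hz : z.re ≤ 0) (t : ℝ) :
    min h 1 / 2 * (1 + |t - z.im|) ≤ ‖vline h t - z‖ := by
  have h1 : h ≤ ‖vline h t - z‖ := by
    have := Complex.abs_re_le_norm (vline h t - z)
    have h2 := le_abs_self (vline h t - z).re
    simp only [Complex.sub_re, vline_re] at this h2
    linarith
  have h2 : |t - z.im| ≤ ‖vline h t - z‖ := by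
    simpa using Complex.abs_im_le_norm (vline h t - z)
  have h3 : min h 1 * |t - z.im| ≤ 1 * |t - z.im| :=
    mul_le_mul_of_nonneg_right (min_le_right _ _) (abs_nonneg _)
  have h4 := min_le_left h 1
  linarith

lemma vline_sub_ne_zero {h : ℝ} (hh : 0 < h) {z : ℂ} (hz : z.re ≤ 0) (t : ℝ) :
    vline h t - z ≠ 0 := by
  intro h0
  have := congrArg Complex.re h0
  simp at this
  linarith

lemma vline_ne_zero {h : ℝ} (hh : 0 < h) (t : ℝ) : vline h t ≠ 0 := by
  simpa using vline_sub_ne_zero hh (z := 0) (by simp) t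

lemma norm_inv_vline_sub_le {h : ℝ} (hh : 0 < h) {z : ℂ} (hz : z.re ≤ 0) (t : ℝ) :
    ‖(vline h t - z)⁻¹‖ ≤ (min h 1 / 2)⁻¹ * (1 + |t - z.im|)⁻¹ := by
  rw [norm_inv, ← mul_inv]
  have : 0 < min h 1 := lt_min hh one_pos
  exact inv_anti₀ (by positivity) (le_norm_vline_sub hz t)

lemma norm_inv_vline_sub_le' {h : ℝ} (hh : 0 < h) {z : ℂ} (hz : z.re ≤ 0) (t : ℝ) :
    ‖(vline h t - z)⁻¹‖ ≤ (min h 1 / 2)⁻¹ := by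
  refine (norm_inv_vline_sub_le hh hz t).trans ?_
  have : 0 < min h 1 := lt_min hh one_pos
  refine mul_le_of_le_one_right (by positivity) (inv_le_one_of_one_le₀ ?_)
  linarith [abs_nonneg (t - z.im)]

lemma norm_inv_vline_le {h : ℝ} (hh : 0 < h) (t : ℝ) :
    ‖(vline h t)⁻¹‖ ≤ (min h 1 / 2)⁻¹ * (1 + |t|)⁻¹ := by
  simpa using norm_inv_vline_sub_le hh (z := 0) (by simp) t

/-- A holomorphic function with quadratic decay on a right half plane has vanishing integral over
the boundary line. -/
lemma integral_vline_eq_zero {h : ℝ} (hh : 0 < h) {g : ℂ → ℂ} {c : ℝ}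
    (hg : ∀ l : ℂ, h ≤ l.re → DifferentiableAt ℂ g l)
    (hc : ∀ l : ℂ, h ≤ l.re → ‖g l‖ ≤ c / ‖l‖ ^ 2)
    (hi : Integrable fun t : ℝ => g (vline h t)) :
    ∫ t : ℝ, g (vline h t) = 0 := by
  have c0 : 0 ≤ c := by
    have h1 := hc h (by simp)
    have h2 : 0 ≤ c / ‖(h : ℂ)‖ ^ 2 := (norm_nonneg _).trans h1
    by_contra hneg
    have : c / ‖(h : ℂ)‖ ^ 2 < 0 := div_neg_of_neg_of_pos (by linarith) (by
      have : (h : ℂ) ≠ 0 := by exact_mod_cast hh.ne'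
      positivity)
    linarith
  have lim := intervalIntegral_tendsto_integral hi tendsto_neg_atTop_atBot tendsto_id
  refine tendsto_nhds_unique lim ?_
  rw [tendsto_zero_iff_norm_tendsto_zero]
  have lim2 : Tendsto (fun r : ℝ => 4 * c / r) atTop (𝓝 0) :=
    tendsto_const_nhds.div_atTop tendsto_id
  refine squeeze_zero' (Eventually.of_forall fun _ => norm_nonneg _) ?_ lim2
  filter_upwards [eventually_gt_atTop 0] with r hr
  have bound : ∀ l : ℂ, h ≤ l.re → r ≤ ‖l‖ → ‖g l‖ ≤ c / r ^ 2 := fun l h1 h2 =>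
    (hc l h1).trans (by gcongr)
  -- On the rectangle $[h,h+r]\times[-r,r]$ the three sides off the line have total length $4r$ and
  -- lie in $|l|\ge r$, whence the bound $4c/r$.
  have key := Complex.integral_boundary_rect_eq_zero_of_differentiableOn g
    (vline h (-r)) (vline (h + r) r) (by
      intro l hl
      refine (hg l ?_).differentiableWithinAt
      have := hl.1
      simp only [vline_re, Set.mem_preimage] at this
      rw [Set.uIcc_of_le (by linarith)] at this
      exact this.1)
  simp only [vline_re, vline_im] at key
  have b1 : ‖∫ x : ℝ in h..(h + r), g (x + ((-r : ℝ) : ℂ) * Complex.I)‖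
      ≤ c / r ^ 2 * |h + r - h| := by
    refine intervalIntegral.norm_integral_le_of_norm_le_const fun x hx => ?_
    rw [Set.uIoc_of_le (by linarith)] at hx
    refine bound _ (by simpa using hx.1.le) ?_
    refine le_trans ?_ (Complex.abs_im_le_norm _)
    simp [abs_of_pos hr]
  have b2 : ‖∫ x : ℝ in h..(h + r), g (x + (r : ℂ) * Complex.I)‖
      ≤ c / r ^ 2 * |h + r - h| := by
    refine intervalIntegral.norm_integral_le_of_norm_le_const fun x hx => ?_
    rw [Set.uIoc_of_le (by linarith)] at hx
    refine bound _ (by simpa using hx.1.le) ?_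
    refine le_trans ?_ (Complex.abs_im_le_norm _)
    simp [abs_of_pos hr]
  have b3 : ‖∫ y : ℝ in (-r)..r, g (((h + r : ℝ) : ℂ) + (y : ℂ) * Complex.I)‖
      ≤ c / r ^ 2 * |r - -r| := by
    refine intervalIntegral.norm_integral_le_of_norm_le_const fun x hx => ?_
    refine bound _ (by simpa using hr.le) ?_
    refine le_trans ?_ (Complex.abs_re_le_norm _)
    simp only [Complex.add_re, Complex.ofReal_re, Complex.mul_re, Complex.I_re, mul_zero,
      Complex.ofReal_im, Complex.I_im, mul_one, sub_self, add_zero]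
    rw [abs_of_pos (by linarith)]; linarith
  simp only [add_sub_cancel_left, abs_of_pos hr, sub_neg_eq_add,
    abs_of_pos (show 0 < r + r by linarith)] at b1 b2 b3
  have e : Complex.I • ∫ t : ℝ in (-r)..r, g (vline h t)
      = ((∫ x : ℝ in h..(h + r), g (x + ((-r : ℝ) : ℂ) * Complex.I))
        - ∫ x : ℝ in h..(h + r), g (x + (r : ℂ) * Complex.I))
        + Complex.I • ∫ y : ℝ in (-r)..r, g (((h + r : ℝ) : ℂ) + (y : ℂ) * Complex.I) :=
    (sub_eq_zero.1 key).symm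
  have n : ‖∫ t : ℝ in (-r)..r, g (vline h t)‖
      = ‖Complex.I • ∫ t : ℝ in (-r)..r, g (vline h t)‖ := by
    rw [norm_smul, Complex.norm_I, one_mul]
  simp only [id]
  rw [n, e]
  refine (norm_add_le _ _).trans ?_
  rw [norm_smul, Complex.norm_I, one_mul]
  have := (norm_sub_le (∫ x : ℝ in h..(h + r), g (x + ((-r : ℝ) : ℂ) * Complex.I))
    (∫ x : ℝ in h..(h + r), g (x + (r : ℂ) * Complex.I)))
  have e4 : 4 * c / r = c / r ^ 2 * r + c / r ^ 2 * r + c / r ^ 2 * (r + r) := by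
    field_simp; ring
  linarith

/-! ### Integrable majorants, and contours closed to the right. -/

lemma integrable_one_add_abs {b : ℝ} (hb : 0 < b) :
    Integrable fun t : ℝ => (1 + |t|) ^ (-(1 + b)) :=
  integrable_one_add_norm (by simpa using hb)

lemma integrable_one_add_abs_sub {b : ℝ} (hb : 0 < b) (a : ℝ) :
    Integrable fun t : ℝ => (1 + |t - a|) ^ (-(1 + b)) :=
  (integrable_one_add_abs hb).comp_sub_right a

/-- Replacing the larger of `u`, `v` by the smaller one decouples two weights centred at different
points. Each summand then has a translation-invariant integral, so bounds for Cauchy kernels do not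
depend on the pole. -/
lemma rpow_neg_mul_inv_le {b u v : ℝ} (hb : 0 < b) (hu : 1 ≤ u) (hv : 1 ≤ v) :
    u ^ (-b) * v⁻¹ ≤ u ^ (-(1 + b)) + v ^ (-(1 + b)) := by
  have hu0 : 0 < u := by linarith
  have hv0 : 0 < v := by linarith
  have e : ∀ w : ℝ, 0 < w → w ^ (-(1 + b)) = w ^ (-b) * w⁻¹ := fun w hw => by
    rw [← Real.rpow_neg_one w, ← Real.rpow_add hw]; ring_nf
  rw [e u hu0, e v hv0]
  rcases le_total u v with h | h
  · have h1 : u ^ (-b) * v⁻¹ ≤ u ^ (-b) * u⁻¹ := by gcongr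
    have : 0 ≤ v ^ (-b) * v⁻¹ := by positivity
    linarith
  · have h1 : u ^ (-b) * v⁻¹ ≤ v ^ (-b) * v⁻¹ :=
      mul_le_mul_of_nonneg_right
        (Real.rpow_le_rpow_of_nonpos hv0 h (by linarith)) (by positivity)
    have : 0 ≤ u ^ (-b) * u⁻¹ := by positivity
    linarith

lemma integrable_of_norm_le_sq {h c : ℝ} {k : ℝ → ℂ} (hk : Continuous k)
    (hb : ∀ t, ‖k t‖ ≤ c * ‖(vline h t)⁻¹‖ ^ 2) (hh : 0 < h) (hc : 0 ≤ c) : Integrable k := by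
  have i := (integrable_one_add_abs one_pos).const_mul (c * ((min h 1 / 2)⁻¹) ^ 2)
  refine i.mono' hk.aestronglyMeasurable (Eventually.of_forall fun t => (hb t).trans ?_)
  have h1 := norm_inv_vline_le hh t
  have e : (1 + |t|) ^ (-(1 + 1 : ℝ)) = ((1 + |t|)⁻¹) ^ 2 := by
    rw [Real.rpow_neg (by positivity), show (1 + 1 : ℝ) = (2 : ℕ) by norm_num, Real.rpow_natCast,
      inv_pow]
  rw [e, mul_assoc, ← mul_pow]
  gcongr

lemma continuous_inv_vline_sub {h : ℝ} (hh : 0 < h) {z : ℂ} (hz : z.re ≤ 0) :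
    Continuous fun t => (vline h t - z)⁻¹ :=
  ((continuous_vline h).sub continuous_const).inv₀ (vline_sub_ne_zero hh hz)

lemma continuous_inv_vline {h : ℝ} (hh : 0 < h) : Continuous fun t => (vline h t)⁻¹ :=
  (continuous_vline h).inv₀ (vline_ne_zero hh)

lemma norm_inv_sub_le_of_re_le {h : ℝ} (hh : 0 < h) {z l : ℂ} (hz : z.re ≤ 0) (hl : h ≤ l.re) :
    ‖(l - z)⁻¹‖ ≤ (1 + ‖z‖ / h) * ‖l⁻¹‖ := by
  have h1 : h ≤ ‖l - z‖ := by
    have := Complex.re_le_norm (l - z)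
    simp only [Complex.sub_re] at this
    linarith
  have h2 : h ≤ ‖l‖ := hl.trans (Complex.re_le_norm l)
  have h3 : ‖l‖ ≤ (1 + ‖z‖ / h) * ‖l - z‖ := by
    have : ‖l‖ ≤ ‖l - z‖ + ‖z‖ := by simpa using norm_add_le (l - z) z
    have h4 : ‖z‖ ≤ ‖z‖ / h * ‖l - z‖ := by
      rw [div_mul_eq_mul_div, le_div_iff₀ hh]; gcongr
    linarith
  rw [norm_inv, norm_inv, ← div_eq_mul_inv, le_div_iff₀ (by linarith), inv_mul_le_iff₀ (by linarith)]
  linarith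

lemma integrable_inv_mul_inv_sub {h : ℝ} (hh : 0 < h) {z : ℂ} (hz : z.re ≤ 0) :
    Integrable fun t => (vline h t)⁻¹ * (vline h t - z)⁻¹ := by
  refine integrable_of_norm_le_sq (c := 1 + ‖z‖ / h) (h := h)
    ((continuous_inv_vline hh).mul (continuous_inv_vline_sub hh hz)) (fun t => ?_) hh (by positivity)
  have := norm_inv_sub_le_of_re_le hh hz (l := vline h t) (by simp)
  rw [norm_mul, sq]
  nlinarith [norm_nonneg (vline h t)⁻¹]

/-- Both poles lie to the left of the line, so the contour closes to the right without residues. -/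
lemma integral_inv_mul_inv_sub {h : ℝ} (hh : 0 < h) {z : ℂ} (hz : z.re ≤ 0) :
    ∫ t, (vline h t)⁻¹ * (vline h t - z)⁻¹ = 0 := by
  refine integral_vline_eq_zero hh (g := fun l => l⁻¹ * (l - z)⁻¹) (c := 1 + ‖z‖ / h)
    (fun l hl => ?_) (fun l hl => ?_) (integrable_inv_mul_inv_sub hh hz)
  · have h1 : l ≠ 0 := by rintro rfl; simp at hl; linarith
    have h2 : l - z ≠ 0 := by
      intro h0
      have := congrArg Complex.re h0
      simp at this; linarith
    fun_prop (disch := assumption)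
  · have := norm_inv_sub_le_of_re_le hh hz hl
    rw [norm_mul, div_eq_mul_inv, ← inv_pow, ← norm_inv]
    nlinarith [norm_nonneg l⁻¹]

lemma integral_inv_sq_mul_inv_sub {h : ℝ} (hh : 0 < h) {z : ℂ} (hz : z.re ≤ 0) :
    ∫ t, ((vline h t)⁻¹) ^ 2 * (vline h t - z)⁻¹ = 0 := by
  have bd : ∀ l : ℂ, h ≤ l.re → ‖(l - z)⁻¹‖ ≤ h⁻¹ := fun l hl => by
    rw [norm_inv]
    refine inv_anti₀ hh ?_
    have := Complex.re_le_norm (l - z)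
    simp only [Complex.sub_re] at this
    linarith
  refine integral_vline_eq_zero hh (g := fun l => (l⁻¹) ^ 2 * (l - z)⁻¹) (c := h⁻¹)
    (fun l hl => ?_) (fun l hl => ?_) ?_
  · have h1 : l ≠ 0 := by rintro rfl; simp at hl; linarith
    have h2 : l - z ≠ 0 := by
      intro h0
      have := congrArg Complex.re h0
      simp at this; linarith
    fun_prop (disch := assumption)
  · have := bd l hl
    rw [norm_mul, div_eq_mul_inv, ← inv_pow, ← norm_inv, norm_pow]
    nlinarith [sq_nonneg ‖l⁻¹‖]
  · refine integrable_of_norm_le_sq (c := h⁻¹) (h := h)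
      (((continuous_inv_vline hh).pow 2).mul (continuous_inv_vline_sub hh hz)) (fun t => ?_) hh
      (by positivity)
    have := bd (vline h t) (by simp)
    rw [norm_mul, norm_pow]
    nlinarith [sq_nonneg ‖(vline h t)⁻¹‖]

lemma integrable_inv_sq {h : ℝ} (hh : 0 < h) : Integrable fun t => ((vline h t)⁻¹) ^ 2 :=
  integrable_of_norm_le_sq (c := 1) (h := h) ((continuous_inv_vline hh).pow 2)
    (fun t => by rw [norm_pow, one_mul]) hh zero_le_one

/-- The principal value of `∫ dl / l` over a vertical line in the right half plane is `iπ`. -/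
lemma tendsto_integral_inv_vline {h : ℝ} (hh : 0 < h) :
    Tendsto (fun r : ℝ => ∫ t in (-r)..r, (vline h t)⁻¹) atTop (𝓝 (Real.pi : ℂ)) := by
  have e : ∀ r : ℝ, ∫ t in (-r)..r, (vline h t)⁻¹ = ((2 * Real.arctan (r / h) : ℝ) : ℂ) := by
    intro r
    set J := ∫ t in (-r)..r, (vline h t)⁻¹ with hJ
    have J' : J = ∫ t in (-r)..r, (vline h (-t))⁻¹ := by
      rw [intervalIntegral.integral_comp_neg (fun t => (vline h t)⁻¹), neg_neg]
    have hcont := continuous_inv_vline hh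
    have hcont' : Continuous fun t => (vline h (-t))⁻¹ := hcont.comp continuous_neg
    -- Adding the values at `t` and `-t` cancels the odd imaginary part and leaves an arctangent
    -- derivative.
    have hs : J + J = ∫ t in (-r)..r, (((2 / h) * (1 + (t / h) ^ 2)⁻¹ : ℝ) : ℂ) := by
      nth_rewrite 2 [J']
      rw [hJ, ← intervalIntegral.integral_add (hcont.intervalIntegrable _ _)
        (hcont'.intervalIntegrable _ _)]
      refine intervalIntegral.integral_congr fun t _ => ?_
      have h1 := vline_ne_zero hh t
      have h2 := vline_ne_zero hh (-t)
      have h3 : (h : ℂ) ≠ 0 := by exact_mod_cast hh.ne'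
      have h5 : vline h t * vline h (-t) = (h : ℂ) ^ 2 + (t : ℂ) ^ 2 := by
        simp only [vline]; push_cast; ring_nf; rw [Complex.I_sq]; ring
      have h6 : vline h t + vline h (-t) = 2 * h := by
        simp only [vline]; push_cast; ring
      have h4 : (h : ℂ) ^ 2 + (t : ℂ) ^ 2 ≠ 0 := by rw [← h5]; exact mul_ne_zero h1 h2
      rw [inv_add_inv h1 h2, h5, h6]
      push_cast
      have h7 : (1 + ((t : ℂ) / h) ^ 2) = (h ^ 2 + t ^ 2) / h ^ 2 := by field_simp
      rw [h7]
      field_simp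
    rw [intervalIntegral.integral_ofReal, intervalIntegral.integral_const_mul,
      intervalIntegral.integral_comp_div (fun t => (1 + t ^ 2)⁻¹) hh.ne',
      integral_inv_one_add_sq, neg_div, Real.arctan_neg] at hs
    have : (2 / h * h • (Real.arctan (r / h) - -Real.arctan (r / h)))
        = 2 * (2 * Real.arctan (r / h)) := by
      rw [smul_eq_mul]; field_simp; ring
    rw [this] at hs
    push_cast at hs ⊢
    linear_combination hs / 2
  simp only [e]
  have l1 : Tendsto (fun r : ℝ => 2 * Real.arctan (r / h)) atTop (𝓝 (2 * (Real.pi / 2))) :=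
    ((Real.tendsto_arctan_atTop.mono_right nhdsWithin_le_nhds).comp
      (tendsto_id.atTop_div_const hh)).const_mul 2
  rw [mul_div_cancel₀ _ (two_ne_zero)] at l1
  exact (Complex.continuous_ofReal.tendsto _).comp l1

/-! ### Decaying pseudo-resolvents on a strip -/

/-- A family of bounded operators satisfying the resolvent identity on the strip `|Re l| ≤ h`
and decaying like `|Im l| ^ (-b)` there. -/
structure DecayingPseudoResolvent (R : ℂ → X →L[ℂ] X) (h C b : ℝ) : Prop where
  h_pos : 0 < h
  b_pos : 0 < b
  identity : ∀ l m : ℂ, |l.re| ≤ h → |m.re| ≤ h → R l - R m = (l - m) • (R l * R m)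
  decay : ∀ l : ℂ, |l.re| ≤ h → ‖R l‖ ≤ C * (1 + |l.im|) ^ (-b)

/-- The normalized integral `(2πi)⁻¹ ∫ k(l) R(l) dl` along the upward line `Re l = h`. -/
def lineInt (R : ℂ → X →L[ℂ] X) (h : ℝ) (k : ℂ → ℂ) : X →L[ℂ] X :=
  ((2 * Real.pi)⁻¹ : ℂ) • ∫ t : ℝ, k (vline h t) • R (vline h t)

namespace DecayingPseudoResolvent

variable {R : ℂ → X →L[ℂ] X} {h C b : ℝ}

lemma C_nonneg (hR : DecayingPseudoResolvent R h C b) : 0 ≤ C := by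
  have := (norm_nonneg _).trans (hR.decay 0 (by simpa using hR.h_pos.le))
  simpa using this

lemma norm_le (hR : DecayingPseudoResolvent R h C b) {l : ℂ} (hl : |l.re| ≤ h) : ‖R l‖ ≤ C := by
  refine (hR.decay l hl).trans (mul_le_of_le_one_right hR.C_nonneg ?_)
  exact Real.rpow_le_one_of_one_le_of_nonpos (by linarith [abs_nonneg l.im]) (by linarith [hR.b_pos])

lemma commute (hR : DecayingPseudoResolvent R h C b) {l m : ℂ} (hl : |l.re| ≤ h)
    (hm : |m.re| ≤ h) : Commute (R l) (R m) := by
  by_cases e : l = m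
  · rw [e]
  have h1 := hR.identity l m hl hm
  have h2 := hR.identity m l hm hl
  have h3 : (l - m) • (R l * R m) = (l - m) • (R m * R l) := by
    rw [← h1, ← neg_sub (R m), h2, ← neg_smul, neg_sub]
  exact smul_right_injective _ (sub_ne_zero.2 e) h3

lemma continuousOn (hR : DecayingPseudoResolvent R h C b) : ContinuousOn R {l | |l.re| ≤ h} := by
  have : LipschitzOnWith (Real.toNNReal (C * C)) R {l | |l.re| ≤ h} := by
    refine LipschitzOnWith.of_dist_le_mul fun l hl m hm => ?_
    rw [dist_eq_norm, dist_eq_norm, hR.identity l m hl hm, norm_smul, mul_comm,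
      Real.coe_toNNReal _ (mul_self_nonneg C)]
    refine mul_le_mul_of_nonneg_right ((norm_mul_le _ _).trans ?_) (norm_nonneg _)
    exact mul_le_mul (hR.norm_le hl) (hR.norm_le hm) (norm_nonneg _) hR.C_nonneg
  exact this.continuousOn

lemma continuous_vline (hR : DecayingPseudoResolvent R h C b) {c : ℝ} (hc : |c| ≤ h) :
    Continuous fun t => R (vline c t) := by
  have := hR.continuousOn.comp (Dichotomy.continuous_vline c).continuousOn (s := Set.univ)
    (fun t _ => by simpa using hc)
  exact continuousOn_univ.1 this

lemma differentiableAt (hR : DecayingPseudoResolvent R h C b) {l : ℂ} (hl : |l.re| < h) :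
    DifferentiableAt ℂ R l := by
  have nhd : {l : ℂ | |l.re| < h} ∈ 𝓝 l :=
    (isOpen_lt (Complex.continuous_re.abs) continuous_const).mem_nhds hl
  have hc : ContinuousAt R l :=
    hR.continuousOn.continuousAt (mem_of_superset nhd fun m (hm : |m.re| < h) => hm.le)
  have hd : HasDerivAt R (R l * R l) l := by
    rw [hasDerivAt_iff_tendsto_slope]
    have t : Tendsto (fun m => R m * R l) (𝓝[≠] l) (𝓝 (R l * R l)) :=
      ((hc.mul continuousAt_const).tendsto).mono_left nhdsWithin_le_nhds
    refine t.congr' ?_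
    filter_upwards [nhdsWithin_le_nhds nhd, self_mem_nhdsWithin] with m hm hne
    rw [slope_def_module, hR.identity m l (le_of_lt hm) hl.le, smul_smul,
      inv_mul_cancel₀ (sub_ne_zero.2 hne), one_smul]
  exact hd.differentiableAt

/-- Reflection in the origin, corresponding to passing from `S` to `-S`. -/
lemma reflect (hR : DecayingPseudoResolvent R h C b) :
    DecayingPseudoResolvent (fun l => -R (-l)) h C b where
  h_pos := hR.h_pos
  b_pos := hR.b_pos
  identity l m hl hm := by
    have := hR.identity (-l) (-m) (by simpa using hl) (by simpa using hm)
    rw [neg_mul_neg, sub_neg_eq_add, neg_add_eq_sub, ← neg_sub, this, ← neg_smul]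
    congr 1; ring
  decay l hl := by
    have := hR.decay (-l) (by simpa using hl)
    simpa using this

/-- A kernel of order $1/|t-a|$ alone just fails to be integrable; the exponent `b` from the
resolvent makes up for it. -/
lemma norm_smul_le (hR : DecayingPseudoResolvent R h C b) {k : ℂ → ℂ} {a c : ℝ} (hc : 0 ≤ c)
    (hb : ∀ t, ‖k (vline h t)‖ ≤ c * (1 + |t - a|)⁻¹) (t : ℝ) :
    ‖k (vline h t) • R (vline h t)‖
      ≤ C * c * ((1 + |t|) ^ (-(1 + b)) + (1 + |t - a|) ^ (-(1 + b))) := by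
  rw [norm_smul]
  have h1 := hR.decay (vline h t) (by simp [abs_of_pos hR.h_pos])
  rw [vline_im] at h1
  have h2 := rpow_neg_mul_inv_le hR.b_pos (u := 1 + |t|) (v := 1 + |t - a|)
    (by linarith [abs_nonneg t]) (by linarith [abs_nonneg (t - a)])
  have h3 := hR.C_nonneg
  calc ‖k (vline h t)‖ * ‖R (vline h t)‖
      ≤ (c * (1 + |t - a|)⁻¹) * (C * (1 + |t|) ^ (-b)) := by
        gcongr
        exact hb t
    _ = C * c * ((1 + |t|) ^ (-b) * (1 + |t - a|)⁻¹) := by ring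
    _ ≤ _ := by gcongr

lemma integrable_smul (hR : DecayingPseudoResolvent R h C b) {k : ℂ → ℂ} {a c : ℝ} (hc : 0 ≤ c)
    (hk : Continuous fun t => k (vline h t)) (hb : ∀ t, ‖k (vline h t)‖ ≤ c * (1 + |t - a|)⁻¹) :
    Integrable fun t => k (vline h t) • R (vline h t) :=
  (((integrable_one_add_abs hR.b_pos).add (integrable_one_add_abs_sub hR.b_pos a)).const_mul
    (C * c)).mono' (hk.smul (hR.continuous_vline (by simp [abs_of_pos hR.h_pos]))).aestronglyMeasurable
    (Eventually.of_forall fun t => hR.norm_smul_le hc hb t)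

lemma norm_lineInt_le (hR : DecayingPseudoResolvent R h C b) {k : ℂ → ℂ} {a c : ℝ} (hc : 0 ≤ c)
    (hb : ∀ t, ‖k (vline h t)‖ ≤ c * (1 + |t - a|)⁻¹) :
    ‖lineInt R h k‖ ≤ ‖((2 * Real.pi)⁻¹ : ℂ)‖ *
      (C * c * (2 * ∫ t : ℝ, (1 + |t|) ^ (-(1 + b)))) := by
  rw [lineInt, norm_smul]
  refine mul_le_mul_of_nonneg_left ?_ (norm_nonneg _)
  have i1 := integrable_one_add_abs hR.b_pos
  have i2 := integrable_one_add_abs_sub hR.b_pos a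
  refine (norm_integral_le_of_norm_le ((i1.add i2).const_mul (C * c))
    (Eventually.of_forall fun t => hR.norm_smul_le hc hb t)).trans (le_of_eq ?_)
  simp only [Pi.add_apply]
  rw [integral_const_mul, integral_add i1 i2,
    integral_sub_right_eq_self (fun t : ℝ => (1 + |t|) ^ (-(1 + b))) a]
  ring

lemma integrable_inv (hR : DecayingPseudoResolvent R h C b) :
    Integrable fun t => (vline h t)⁻¹ • R (vline h t) := by
  have : 0 < min h 1 := lt_min hR.h_pos one_pos
  exact hR.integrable_smul (k := fun l => l⁻¹) (a := 0) (c := (min h 1 / 2)⁻¹) (by positivity)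
    (continuous_inv_vline hR.h_pos) (fun t => by
      rw [sub_zero]; exact norm_inv_vline_le hR.h_pos t)

lemma integrable_inv_sub_smul (hR : DecayingPseudoResolvent R h C b) {z : ℂ} (hz : z.re ≤ 0) :
    Integrable fun t => (vline h t - z)⁻¹ • R (vline h t) := by
  have : 0 < min h 1 := lt_min hR.h_pos one_pos
  exact hR.integrable_smul (k := fun l => (l - z)⁻¹) (by positivity)
    (continuous_inv_vline_sub hR.h_pos hz) (fun t => norm_inv_vline_sub_le hR.h_pos hz t)

lemma integrable_inv_mul_inv_sub_smul (hR : DecayingPseudoResolvent R h C b) {z : ℂ}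
    (hz : z.re ≤ 0) :
    Integrable fun t => ((vline h t)⁻¹ * (vline h t - z)⁻¹) • R (vline h t) := by
  have : 0 < min h 1 := lt_min hR.h_pos one_pos
  refine hR.integrable_smul (k := fun l => l⁻¹ * (l - z)⁻¹) (a := 0)
    (c := (min h 1 / 2)⁻¹ * (min h 1 / 2)⁻¹) (by positivity)
    ((continuous_inv_vline hR.h_pos).mul (continuous_inv_vline_sub hR.h_pos hz)) (fun t => ?_)
  have h1 := norm_inv_vline_le hR.h_pos t
  have h2 := norm_inv_vline_sub_le' hR.h_pos hz t
  rw [norm_mul, sub_zero, mul_right_comm]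
  gcongr

/-- The integrals with a Cauchy kernel are uniformly bounded on the closed left half plane. -/
lemma exists_norm_lineInt_inv_sub_le (hR : DecayingPseudoResolvent R h C b) :
    ∃ K : ℝ, ∀ z : ℂ, z.re ≤ 0 → ‖lineInt R h fun l => (l - z)⁻¹‖ ≤ K := by
  have : 0 < min h 1 := lt_min hR.h_pos one_pos
  exact ⟨_, fun z hz => hR.norm_lineInt_le (k := fun l => (l - z)⁻¹) (c := (min h 1 / 2)⁻¹)
    (by positivity) (fun t => norm_inv_vline_sub_le hR.h_pos hz t)⟩

end DecayingPseudoResolvent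

lemma commute_lineInt [CompleteSpace X] {R : ℂ → X →L[ℂ] X} {h : ℝ} {k : ℂ → ℂ}
    {T : X →L[ℂ] X} (hi : Integrable fun t => k (vline h t) • R (vline h t))
    (hT : ∀ t, Commute T (R (vline h t))) : Commute T (lineInt R h k) := by
  have h1 : ∫ t, T * (k (vline h t) • R (vline h t)) = T * ∫ t, k (vline h t) • R (vline h t) :=
    (ContinuousLinearMap.mul ℂ (X →L[ℂ] X) T).integral_comp_comm hi
  have h2 : ∫ t, (k (vline h t) • R (vline h t)) * T = (∫ t, k (vline h t) • R (vline h t)) * T :=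
    ((ContinuousLinearMap.mul ℂ (X →L[ℂ] X)).flip T).integral_comp_comm hi
  refine Commute.smul_right ?_ _
  rw [commute_iff_eq, ← h1, ← h2]
  refine integral_congr_ae (Eventually.of_forall fun t => ?_)
  simp only [mul_smul_comm, smul_mul_assoc, (hT t).eq]

/-! ### Products of contour integrals with the resolvent, and shifts of the contour. -/

namespace DecayingPseudoResolvent

variable {R : ℂ → X →L[ℂ] X} {h C b : ℝ} [CompleteSpace X]

/-- By the resolvent identity $R(z)R(l)=(l-z)^{-1}(R(l)-R(z))$; the term with the constant operator
$R(z)$ drops out by `h0`. -/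
lemma mul_lineInt (hR : DecayingPseudoResolvent R h C b) {z : ℂ} (hzh : |z.re| ≤ h)
    (hz : z.re ≤ 0) {k : ℂ → ℂ}
    (hi : Integrable fun t => k (vline h t) • R (vline h t))
    (hi' : Integrable fun t => (k (vline h t) * (vline h t - z)⁻¹) • R (vline h t))
    (hs : Integrable fun t => k (vline h t) * (vline h t - z)⁻¹)
    (h0 : ∫ t, k (vline h t) * (vline h t - z)⁻¹ = 0) :
    R z * lineInt R h k = lineInt R h fun l => k l * (l - z)⁻¹ := by
  have h1 : ∫ t, R z * (k (vline h t) • R (vline h t))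
      = R z * ∫ t, k (vline h t) • R (vline h t) :=
    (ContinuousLinearMap.mul ℂ (X →L[ℂ] X) (R z)).integral_comp_comm hi
  rw [lineInt, lineInt, mul_smul_comm, ← h1]
  congr 1
  have h2 : ∀ t, R z * (k (vline h t) • R (vline h t))
      = (k (vline h t) * (vline h t - z)⁻¹) • R (vline h t)
        - (k (vline h t) * (vline h t - z)⁻¹) • R z := fun t => by
    have hl : |(vline h t).re| ≤ h := by simp [abs_of_pos hR.h_pos]
    rw [← smul_sub, hR.identity _ _ hl hzh, (hR.commute hl hzh).eq, smul_smul, mul_assoc,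
      inv_mul_cancel₀ (vline_sub_ne_zero hR.h_pos hz t), mul_one, mul_smul_comm]
  simp only [h2]
  rw [integral_sub hi' (hs.smul_const _), integral_smul_const, h0, zero_smul, sub_zero]

lemma mul_lineInt_inv (hR : DecayingPseudoResolvent R h C b) {z : ℂ} (hzh : |z.re| ≤ h)
    (hz : z.re ≤ 0) :
    R z * lineInt R h (fun l => l⁻¹) = lineInt R h fun l => l⁻¹ * (l - z)⁻¹ :=
  hR.mul_lineInt hzh hz hR.integrable_inv (hR.integrable_inv_mul_inv_sub_smul hz)
    (integrable_inv_mul_inv_sub hR.h_pos hz) (integral_inv_mul_inv_sub hR.h_pos hz)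

lemma zero_mul_lineInt_inv (hR : DecayingPseudoResolvent R h C b) :
    R 0 * lineInt R h (fun l => l⁻¹) = lineInt R h fun l => (l⁻¹) ^ 2 := by
  rw [hR.mul_lineInt_inv (by simpa using hR.h_pos.le) (by simp)]
  simp only [sub_zero, sq]

lemma zero_mul_lineInt_inv_sub (hR : DecayingPseudoResolvent R h C b) {z : ℂ} (hz : z.re ≤ 0) :
    R 0 * lineInt R h (fun l => (l - z)⁻¹) = lineInt R h fun l => l⁻¹ * (l - z)⁻¹ := by
  have e : ∀ l : ℂ, (l - z)⁻¹ * (l - 0)⁻¹ = l⁻¹ * (l - z)⁻¹ := fun l => by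
    rw [sub_zero, mul_comm]
  rw [hR.mul_lineInt (by simpa using hR.h_pos.le) (by simp) (hR.integrable_inv_sub_smul hz)]
  · simp only [e]
  · simpa only [e] using hR.integrable_inv_mul_inv_sub_smul hz
  · simpa only [e] using integrable_inv_mul_inv_sub hR.h_pos hz
  · simpa only [e] using integral_inv_mul_inv_sub hR.h_pos hz

/-- Integrated form of $\frac1{l-z}=\frac z{l(l-z)}+\frac1l$. -/
lemma lineInt_inv_sub_eq (hR : DecayingPseudoResolvent R h C b) {z : ℂ} (hz : z.re ≤ 0) :
    lineInt R h (fun l => (l - z)⁻¹)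
      = z • (R 0 * lineInt R h (fun l => (l - z)⁻¹)) + lineInt R h fun l => l⁻¹ := by
  have i1 : Integrable fun t => z • ((vline h t)⁻¹ * (vline h t - z)⁻¹) • R (vline h t) :=
    (hR.integrable_inv_mul_inv_sub_smul hz).smul z
  rw [hR.zero_mul_lineInt_inv_sub hz, lineInt, lineInt, lineInt, smul_comm z, ← smul_add,
    ← integral_smul z, ← integral_add i1 hR.integrable_inv]
  congr 1
  refine integral_congr_ae (Eventually.of_forall fun t => ?_)
  have h1 := vline_sub_ne_zero hR.h_pos hz t
  have h2 := vline_ne_zero hR.h_pos t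
  simp only [smul_smul]
  rw [← add_smul]
  congr 1
  field_simp
  ring

/-- The integral operators over the two boundary lines of the strip annihilate each other. -/
lemma lineInt_reflect_mul_lineInt (hR : DecayingPseudoResolvent R h C b) :
    lineInt (fun l => -R (-l)) h (fun l => (l⁻¹) ^ 2) * lineInt R h (fun l => l⁻¹) = 0 := by
  set B := lineInt R h (fun l => l⁻¹) with hB
  have hh := hR.h_pos
  have hre : ∀ s, (-vline h s).re ≤ 0 := fun s => by simpa using hh.le
  have i1 : Integrable fun t => ((vline h t)⁻¹) ^ 2 • (-R (-vline h t)) := by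
    have : 0 < min h 1 := lt_min hR.h_pos one_pos
    refine hR.reflect.integrable_smul (k := fun l => (l⁻¹) ^ 2) (a := 0)
      (c := (min h 1 / 2)⁻¹ * (min h 1 / 2)⁻¹) (by positivity)
      ((continuous_inv_vline hh).pow 2) (fun t => ?_)
    have h1 := norm_inv_vline_le hh t
    have h2 := norm_inv_vline_sub_le' hh (z := 0) (by simp) t
    rw [sub_zero] at h2
    rw [norm_pow, sq, sub_zero, mul_right_comm]
    gcongr
  have h2 : ∫ t, (((vline h t)⁻¹) ^ 2 • (-R (-vline h t))) * B
      = (∫ t, ((vline h t)⁻¹) ^ 2 • (-R (-vline h t))) * B :=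
    ((ContinuousLinearMap.mul ℂ (X →L[ℂ] X)).flip B).integral_comp_comm i1
  rw [lineInt, smul_mul_assoc, ← h2]
  -- `mul_lineInt_inv` at the point `-vline h s` of the left boundary line removes one resolvent
  -- factor and produces a double integral.
  have h3 : ∀ s, (((vline h s)⁻¹) ^ 2 • (-R (-vline h s))) * B
      = (-((2 * Real.pi)⁻¹ : ℂ)) • ∫ t, (((vline h s)⁻¹) ^ 2 * (vline h t - -vline h s)⁻¹) •
          ((vline h t)⁻¹ • R (vline h t)) := fun s => by
    rw [smul_mul_assoc, neg_mul, hB, hR.mul_lineInt_inv (by simp [abs_of_pos hh]) (hre s), lineInt,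
      smul_neg, neg_smul, smul_comm, ← integral_smul]
    simp only [smul_smul]
    congr 3
    funext t
    congr 1
    ring
  simp only [h3]
  rw [integral_smul, integral_integral_swap]
  -- After the swap the inner integral is scalar, with poles at `0` and `-vline h t`, both left of
  -- the contour.
  · have h4 : ∀ t, ∫ s, (((vline h s)⁻¹) ^ 2 * (vline h t - -vline h s)⁻¹) •
          ((vline h t)⁻¹ • R (vline h t)) = 0 := fun t => by
      have e : ∀ s, vline h t - -vline h s = vline h s - -vline h t := fun s => by ring
      rw [integral_smul_const]
      simp only [e]
      rw [integral_inv_sq_mul_inv_sub hh (hre t), zero_smul]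
    simp only [h4, integral_zero, smul_zero]
  · have i2 := ((integrable_inv_sq hh).norm.mul_prod hR.integrable_inv.norm).const_mul
      ((min h 1 / 2)⁻¹)
    refine i2.mono' ?_ (Eventually.of_forall fun p => ?_)
    · refine Continuous.aestronglyMeasurable ?_
      have c1 := continuous_inv_vline hh
      have c2 := Dichotomy.continuous_vline h
      have c3 := hR.continuous_vline (c := h) (by simp [abs_of_pos hh])
      have c4 : Continuous fun p : ℝ × ℝ => (vline h p.2 - -vline h p.1)⁻¹ :=
        ((c2.comp continuous_snd).sub (c2.comp continuous_fst).neg).inv₀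
          (fun p => vline_sub_ne_zero hh (hre p.1) p.2)
      exact (((c1.comp continuous_fst).pow 2).mul c4).smul
        ((c1.comp continuous_snd).smul (c3.comp continuous_snd))
    · have := norm_inv_vline_sub_le' hh (hre p.1) p.2
      simp only [Function.uncurry]
      rw [norm_smul, norm_mul, mul_comm ‖_‖ ‖(vline h p.2 - -vline h p.1)⁻¹‖, mul_assoc]
      gcongr

/-- The principal value of `∫ R(l) R(0) y dl` over the imaginary axis. -/
lemma tendsto_integral_imaginary_axis (hR : DecayingPseudoResolvent R h C b) (y : X) :
    Tendsto (fun r : ℝ => ∫ t in (-r)..r, R (vline 0 t) (R 0 y)) atTop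
      (𝓝 ((2 * Real.pi : ℂ) • lineInt R h (fun l => l⁻¹) y - (Real.pi : ℂ) • R 0 y)) := by
  have hh := hR.h_pos
  set x := R 0 y with hx
  have pi0 : (2 * Real.pi : ℂ) ≠ 0 := by simp [Real.pi_ne_zero]
  have hc : ContinuousOn (fun l => R l x) {l | |l.re| ≤ h} :=
    hR.continuousOn.clm_apply continuousOn_const
  have hline : Tendsto (fun r : ℝ => ∫ t in (-r)..r, R (vline h t) x) atTop
      (𝓝 ((2 * Real.pi : ℂ) • lineInt R h (fun l => l⁻¹) y - (Real.pi : ℂ) • x)) := by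
    have iy : Integrable fun t => (vline h t)⁻¹ • R (vline h t) y :=
      hR.integrable_inv.apply_continuousLinearMap y
    have e1 : (2 * Real.pi : ℂ) • lineInt R h (fun l => l⁻¹) y
        = ∫ t, (vline h t)⁻¹ • R (vline h t) y := by
      rw [lineInt, smul_apply, smul_smul, mul_inv_cancel₀ pi0, one_smul,
        ContinuousLinearMap.integral_apply hR.integrable_inv]
      rfl
    rw [e1]
    have l1 := intervalIntegral_tendsto_integral iy tendsto_neg_atTop_atBot tendsto_id
    have l2 := (tendsto_integral_inv_vline hh).smul_const x
    have cx : Continuous fun t => (vline h t)⁻¹ • x :=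
      (continuous_inv_vline hh).smul continuous_const
    refine (l1.sub l2).congr fun r => ?_
    simp only [id]
    rw [← intervalIntegral.integral_smul_const, ← intervalIntegral.integral_sub
      iy.intervalIntegrable (cx.intervalIntegrable _ _)]
    refine intervalIntegral.integral_congr fun t _ => ?_
    have hid := hR.identity (vline h t) 0 (by simp [abs_of_pos hh]) (by simpa using hh.le)
    have hid' := congrArg (fun T : X →L[ℂ] X => T y) hid
    simp only [sub_zero, sub_apply, smul_apply,
      mul_apply_eq_comp] at hid'
    rw [← smul_sub, hx, hid', smul_smul, inv_mul_cancel₀ (vline_ne_zero hh t), one_smul]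
  have hdiff : Tendsto (fun r : ℝ => (∫ t in (-r)..r, R (vline 0 t) x)
      - ∫ t in (-r)..r, R (vline h t) x) atTop (𝓝 0) := by
    rw [tendsto_zero_iff_norm_tendsto_zero]
    have lim2 : Tendsto (fun r : ℝ => 2 * (C * ‖x‖ * h) * (1 + r) ^ (-b)) atTop (𝓝 0) := by
      have := ((tendsto_rpow_neg_atTop hR.b_pos).comp
        (tendsto_atTop_add_const_left atTop (1 : ℝ) tendsto_id)).const_mul (2 * (C * ‖x‖ * h))
      simpa using this
    refine squeeze_zero' (Eventually.of_forall fun _ => norm_nonneg _) ?_ lim2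
    filter_upwards [eventually_gt_atTop 0] with r hr
    -- The right side lies on the edge of the strip, where only continuity is available; holomorphy
    -- holds in the interior. The horizontal sides have fixed length `h` and vanish by the decay of
    -- `R`.
    have key := Complex.integral_boundary_rect_eq_zero_of_continuousOn_of_differentiableOn
      (fun l => R l x) (vline 0 (-r)) (vline h r) (hc.mono ?_) ?_
    · simp only [vline_re, vline_im] at key
      have bd : ∀ s : ℝ, |s| = r → ‖∫ u : ℝ in (0 : ℝ)..h, R (u + (s : ℂ) * Complex.I) x‖
          ≤ C * (1 + r) ^ (-b) * ‖x‖ * |h - 0| := fun s hs => by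
        refine intervalIntegral.norm_integral_le_of_norm_le_const fun u hu => ?_
        rw [Set.uIoc_of_le hh.le] at hu
        refine (ContinuousLinearMap.le_opNorm _ _).trans ?_
        gcongr
        have := hR.decay (u + (s : ℂ) * Complex.I) (by simpa [abs_of_pos hu.1] using hu.2)
        simpa [hs] using this
      have b1 := bd (-r) (by rw [abs_neg, abs_of_pos hr])
      have b2 := bd r (abs_of_pos hr)
      rw [sub_zero, abs_of_pos hh] at b1 b2
      have e : Complex.I • ((∫ t in (-r)..r, R (vline 0 t) x) - ∫ t in (-r)..r, R (vline h t) x)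
          = (∫ u : ℝ in (0 : ℝ)..h, R (u + ((-r : ℝ) : ℂ) * Complex.I) x)
            - ∫ u : ℝ in (0 : ℝ)..h, R (u + (r : ℂ) * Complex.I) x := by
        rw [smul_sub]
        simp only [vline]
        rw [sub_eq_zero] at key
        rw [← key]
        abel
      have n : ‖(∫ t in (-r)..r, R (vline 0 t) x) - ∫ t in (-r)..r, R (vline h t) x‖
          = ‖Complex.I • ((∫ t in (-r)..r, R (vline 0 t) x)
            - ∫ t in (-r)..r, R (vline h t) x)‖ := by
        rw [norm_smul, Complex.norm_I, one_mul]
      rw [n, e]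
      refine (norm_sub_le _ _).trans ((add_le_add b1 b2).trans (le_of_eq ?_))
      ring
    · intro l hl
      have := hl.1
      simp only [vline_re, Set.mem_preimage] at this
      rw [Set.uIcc_of_le hh.le] at this
      simpa [abs_of_nonneg this.1] using this.2
    · intro l hl
      have := hl.1
      simp only [vline_re, Set.mem_preimage, min_eq_left hh.le, max_eq_right hh.le] at this
      have hd := hR.differentiableAt (l := l) (by rw [abs_of_pos this.1]; exact this.2)
      exact (hd.clm_apply (differentiableAt_const x)).differentiableWithinAt
  have := hdiff.add hline
  simpa using this

/-- Reflecting the contour, the two line integrals differ by a residue at the origin. -/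
lemma lineInt_sub_lineInt_reflect (hR : DecayingPseudoResolvent R h C b) (y : X) :
    lineInt R h (fun l => l⁻¹) y - lineInt (fun l => -R (-l)) h (fun l => l⁻¹) y = R 0 y := by
  have h1 := hR.tendsto_integral_imaginary_axis y
  have h2 := (hR.reflect.tendsto_integral_imaginary_axis (-y)).neg
  -- The principal value over the symmetric axis is unchanged by $t\mapsto-t$, so both limit
  -- formulas compute the same integral.
  have e : ∀ r : ℝ, -∫ t in (-r)..r, (-R (-vline 0 t)) ((-R (-0)) (-y))
      = ∫ t in (-r)..r, R (vline 0 t) (R 0 y) := fun r => by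
    have := intervalIntegral.integral_comp_neg (a := -r) (b := r)
      (fun t => R (vline 0 t) (R 0 y))
    rw [neg_neg] at this
    rw [← this, ← intervalIntegral.integral_neg]
    refine intervalIntegral.integral_congr fun t _ => ?_
    simp [vline]
  simp only [e] at h2
  have h3 := tendsto_nhds_unique h1 h2
  simp only [neg_zero, map_neg, neg_apply, neg_neg, smul_neg] at h3
  have pi0 : (2 * Real.pi : ℂ) ≠ 0 := by simp [Real.pi_ne_zero]
  refine smul_right_injective X pi0 ?_
  simp only [smul_sub]
  have h4 : (2 * Real.pi : ℂ) • R 0 y = (Real.pi : ℂ) • R 0 y + (Real.pi : ℂ) • R 0 y := by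
    rw [← add_smul]; congr 1; ring
  rw [h4]
  rw [sub_eq_iff_eq_add] at h3
  rw [h3]
  abel

end DecayingPseudoResolvent

/-! ### Resolvents of unbounded operators -/

lemma IsResolventAt.unique {S : X →ₗ.[ℂ] X} {l : ℂ} {R R' : X →L[ℂ] X}
    (h : IsResolventAt S l R) (h' : IsResolventAt S l R') : R = R' := by
  ext y
  obtain ⟨hy, e⟩ := h.1 y
  have := h'.2 ⟨R y, hy⟩
  rw [e] at this
  exact this.symm

lemma isResolventAt_resolvent {S : X →ₗ.[ℂ] X} {l : ℂ} (hl : l ∈ resolventSet S) :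
    IsResolventAt S l (resolvent S l) := by
  have h : ∃ R : X →L[ℂ] X, IsResolventAt S l R := hl
  rw [resolvent, dif_pos h]
  exact h.choose_spec

lemma IsResolventAt.resolvent_eq {S : X →ₗ.[ℂ] X} {l : ℂ} {R : X →L[ℂ] X}
    (h : IsResolventAt S l R) : resolvent S l = R :=
  (isResolventAt_resolvent ⟨R, h⟩).unique h

lemma IsResolventAt.identity {S : X →ₗ.[ℂ] X} {l m : ℂ} {R Q : X →L[ℂ] X}
    (hR : IsResolventAt S l R) (hQ : IsResolventAt S m Q) : R - Q = (l - m) • (R * Q) := by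
  ext y
  obtain ⟨hy, e⟩ := hQ.1 y
  have h1 := hR.2 ⟨Q y, hy⟩
  have h2 : S ⟨Q y, hy⟩ - l • Q y = y - (l - m) • Q y := by
    rw [sub_smul]; nth_rewrite 3 [← e]; abel
  simp only at h1
  rw [h2, map_sub, map_smul] at h1
  simp only [sub_apply, smul_apply, mul_apply_eq_comp]
  nth_rewrite 1 [← h1]
  abel

lemma IsResolventAt.mem_domain {S : X →ₗ.[ℂ] X} {R : X →L[ℂ] X} (hR : IsResolventAt S 0 R)
    (y : X) : R y ∈ S.domain := (hR.1 y).1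

lemma IsResolventAt.apply_zero {S : X →ₗ.[ℂ] X} {R : X →L[ℂ] X} (hR : IsResolventAt S 0 R)
    (y : X) : S ⟨R y, hR.mem_domain y⟩ = y := by
  obtain ⟨_, e⟩ := hR.1 y
  simpa using e

lemma IsResolventAt.zero_apply {S : X →ₗ.[ℂ] X} {R : X →L[ℂ] X} (hR : IsResolventAt S 0 R)
    (x : S.domain) : R (S x) = x := by
  simpa using hR.2 x

lemma IsResolventAt.injective {S : X →ₗ.[ℂ] X} {R : X →L[ℂ] X} (hR : IsResolventAt S 0 R) :
    Function.Injective R := fun y y' h => by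
  rw [← hR.apply_zero y, ← hR.apply_zero y']
  congr 1
  exact Subtype.ext h

/-- Neumann series: resolvent points are stable under small perturbations. -/
lemma IsResolventAt.exists_near [CompleteSpace X] {S : X →ₗ.[ℂ] X} {l m : ℂ} {R : X →L[ℂ] X}
    (hR : IsResolventAt S l R) (hm : ‖m - l‖ * ‖R‖ ≤ 1 / 2) :
    m ∈ resolventSet S ∧ ‖resolvent S m‖ ≤ 2 * ‖R‖ := by
  have hn : ‖(m - l) • R‖ < 1 := by rw [norm_smul]; linarith
  set u := Units.oneSub ((m - l) • R) hn with hu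
  have hu' : (u : X →L[ℂ] X) = 1 - (m - l) • R := rfl
  set V : X →L[ℂ] X := ((u⁻¹ : (X →L[ℂ] X)ˣ) : X →L[ℂ] X) with hV
  have uV : ∀ y, V y - (m - l) • R (V y) = y := fun y => by
    have := congrArg (fun T : X →L[ℂ] X => T y) u.mul_inv
    rw [hu'] at this
    simpa using this
  have Vu : ∀ y, V (y - (m - l) • R y) = y := fun y => by
    have := congrArg (fun T : X →L[ℂ] X => T y) u.inv_mul
    rw [hu'] at this
    simpa using this
  have hres : IsResolventAt S m (R * V) := by
    refine ⟨fun y => ?_, fun x => ?_⟩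
    · obtain ⟨hy, e⟩ := hR.1 (V y)
      refine ⟨hy, ?_⟩
      have h1 : S ⟨R (V y), hy⟩ = V y + l • R (V y) := by rw [← sub_eq_iff_eq_add, e]
      change S ⟨R (V y), hy⟩ - m • R (V y) = y
      rw [h1]
      nth_rewrite 4 [← uV y]
      rw [sub_smul]
      abel
    · have h1 := hR.2 x
      have h2 : S x - m • (x : X)
          = (S x - l • (x : X)) - (m - l) • R (S x - l • (x : X)) := by
        rw [h1, sub_smul]; abel
      rw [h2, mul_apply_eq_comp, Vu, h1]
  refine ⟨⟨_, hres⟩, ?_⟩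
  rw [hres.resolvent_eq]
  -- The resolvent identity gives $\|RV\|\le\|R\|+\frac12\|RV\|$, hence the factor 2.
  have h1 := hR.identity hres
  have h2 : R * V = R - (l - m) • (R * (R * V)) := by rw [← h1]; abel
  have h3 : ‖R * V‖ ≤ ‖R‖ + ‖m - l‖ * (‖R‖ * ‖R * V‖) := by
    nth_rewrite 1 [h2]
    refine (norm_sub_le _ _).trans ?_
    rw [norm_smul, norm_sub_rev l m]
    gcongr
    exact norm_mul_le _ _
  have h4 : ‖m - l‖ * ‖R‖ * ‖R * V‖ ≤ 1 / 2 * ‖R * V‖ := by gcongr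
  linarith

/-- An almost bisectorial operator has a resolvent bounded on the whole imaginary axis. -/
lemma AlmostBisectorial.exists_norm_le_imag [CompleteSpace X] {S : X →ₗ.[ℂ] X}
    (hS : AlmostBisectorial S) :
    ∃ K : ℝ, ∀ l : ℂ, l.re = 0 → l ∈ resolventSet S ∧ ‖resolvent S l‖ ≤ K := by
  obtain ⟨h1, b, b0, b1, M, hM⟩ := hS
  -- As $b<1$, the resolvent at $id$ grows more slowly than $1/d$. For small `d` its Neumann disc
  -- therefore contains all $|l|\le d$, in particular the origin.
  have lim : Tendsto (fun d : ℝ => 2 * M * d ^ (1 - b)) (𝓝[>] 0) (𝓝 0) := by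
    have : ContinuousAt (fun d : ℝ => 2 * M * d ^ (1 - b)) 0 :=
      continuousAt_const.mul (Real.continuousAt_rpow_const _ _ (Or.inr (by linarith)))
    have h := this.tendsto
    rw [Real.zero_rpow (by linarith), mul_zero] at h
    exact h.mono_left nhdsWithin_le_nhds
  obtain ⟨d, hd, hd0⟩ := ((lim.eventually (gt_mem_nhds (show (0 : ℝ) < 1 / 2 by norm_num))).and
    self_mem_nhdsWithin).exists
  have d0 : 0 < d := hd0
  set p : ℂ := (d : ℂ) * Complex.I with hp
  have pre : p.re = 0 := by simp [hp]
  have pn : ‖p‖ = d := by simp [hp, abs_of_pos d0]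
  have p0 : p ≠ 0 := norm_pos_iff.1 (by rw [pn]; exact d0)
  have hRp := isResolventAt_resolvent (h1 p pre p0)
  have nRp := hM p pre p0
  rw [pn] at nRp
  have M0 : 0 ≤ M := by
    have := (norm_nonneg _).trans nRp
    have hpos : 0 < d ^ b := Real.rpow_pos_of_pos d0 b
    by_contra hneg
    have := div_neg_of_neg_of_pos (not_le.1 hneg) hpos
    linarith
  have small : 2 * d * ‖resolvent S p‖ ≤ 1 / 2 := by
    have : 2 * d * ‖resolvent S p‖ ≤ 2 * d * (M / d ^ b) := by gcongr
    refine this.trans (le_trans (le_of_eq ?_) hd.le)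
    rw [Real.rpow_sub d0, Real.rpow_one]
    ring
  refine ⟨max (2 * ‖resolvent S p‖) (M / d ^ b), fun l hl => ?_⟩
  rcases le_total ‖l‖ d with h | h
  · have h2 : ‖l - p‖ ≤ 2 * d := (norm_sub_le _ _).trans (by rw [pn]; linarith)
    have h3 := hRp.exists_near (m := l)
      ((mul_le_mul_of_nonneg_right h2 (norm_nonneg _)).trans small)
    exact ⟨h3.1, h3.2.trans (le_max_left _ _)⟩
  · have l0 : l ≠ 0 := norm_pos_iff.1 (by linarith)
    refine ⟨h1 l hl l0, (hM l hl l0).trans (le_trans ?_ (le_max_right _ _))⟩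
    gcongr

lemma AlmostBisectorial.exists_boundedOnStrip [CompleteSpace X] {S : X →ₗ.[ℂ] X}
    (hS : AlmostBisectorial S) : ∃ h : ℝ, BoundedOnStrip S h := by
  obtain ⟨K, hK⟩ := hS.exists_norm_le_imag
  have K0 : 0 ≤ K := (norm_nonneg _).trans (hK 0 (by simp)).2
  have near : ∀ l : ℂ, |l.re| ≤ 1 / (2 * (K + 1)) →
      l ∈ resolventSet S ∧ ‖resolvent S l‖ ≤ 2 * K := fun l hl => by
    obtain ⟨h1, h2⟩ := hK ((l.im : ℂ) * Complex.I) (by simp)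
    have e : l - (l.im : ℂ) * Complex.I = (l.re : ℂ) := by
      nth_rewrite 1 [← Complex.re_add_im l]; ring
    have h3 := (isResolventAt_resolvent h1).exists_near (m := l) (by
      rw [e, Complex.norm_real, Real.norm_eq_abs]
      calc |l.re| * ‖resolvent S ((l.im : ℂ) * Complex.I)‖ ≤ 1 / (2 * (K + 1)) * (K + 1) := by
            gcongr; linarith
        _ = 1 / 2 := by field_simp)
    exact ⟨h3.1, h3.2.trans (by linarith)⟩
  -- The width keeps distance times resolvent norm at most `1/2`; `K + 1` guards against `K = 0`.
  exact ⟨1 / (2 * (K + 1)), by positivity, fun l hl => (near l hl).1, 2 * K,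
    fun l hl => (near l hl).2⟩

lemma AlmostBisectorial.exists_decayingPseudoResolvent {S : X →ₗ.[ℂ] X}
    (hS : AlmostBisectorial S) {h : ℝ} (hh : BoundedOnStrip S h) :
    ∃ C b : ℝ, DecayingPseudoResolvent (resolvent S) h C b := by
  obtain ⟨-, b, b0, -, M, hM⟩ := hS
  obtain ⟨h0, hρ, K, hK⟩ := hh
  have K0 : 0 ≤ K := (norm_nonneg _).trans (hK 0 (by simpa using h0.le))
  have M0 : 0 ≤ M := by
    have := (norm_nonneg _).trans (hM Complex.I (by simp) Complex.I_ne_zero)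
    simpa using this
  have ident : ∀ l m : ℂ, |l.re| ≤ h → |m.re| ≤ h →
      resolvent S l - resolvent S m = (l - m) • (resolvent S l * resolvent S m) :=
    fun l m hl hm => (isResolventAt_resolvent (hρ l hl)).identity (isResolventAt_resolvent (hρ m hm))
  -- `K` serves $|\operatorname{Im} l|\le1$. Beyond that, comparison with $i\operatorname{Im} l$
  -- costs the factor `1 + h * K`. The power of 2 absorbs the passage to $1+|\operatorname{Im} l|$.
  refine ⟨(K + M * (1 + h * K)) * 2 ^ b, b, h0, b0, ident, fun l hl => ?_⟩
  rw [mul_assoc]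
  rcases le_total |l.im| 1 with ht | ht
  · have h1 : 1 ≤ (2 : ℝ) ^ b * (1 + |l.im|) ^ (-b) := by
      rw [Real.rpow_neg (by positivity), ← div_eq_mul_inv, one_le_div (by positivity)]
      exact Real.rpow_le_rpow (by positivity) (by linarith) b0.le
    calc ‖resolvent S l‖ ≤ K := hK l hl
      _ ≤ (K + M * (1 + h * K)) * 1 := by
        rw [mul_one]; exact le_add_of_nonneg_right (by positivity)
      _ ≤ _ := by gcongr
  · set m : ℂ := (l.im : ℂ) * Complex.I with hm
    have mre : m.re = 0 := by simp [hm]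
    have mn : ‖m‖ = |l.im| := by simp [hm]
    have m0 : m ≠ 0 := norm_pos_iff.1 (by linarith)
    have hRm := hM m mre m0
    rw [mn] at hRm
    have e : l - m = (l.re : ℂ) := by
      rw [hm]; nth_rewrite 1 [← Complex.re_add_im l]; ring
    have id1 := ident l m hl (by rw [mre]; simpa using h0.le)
    have h2 : ‖resolvent S l‖ ≤ (1 + h * K) * ‖resolvent S m‖ := by
      have h3 : resolvent S l = resolvent S m + (l - m) • (resolvent S l * resolvent S m) := by
        rw [← id1]; abel
      rw [h3]
      refine (norm_add_le _ _).trans ?_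
      rw [norm_smul, e, Complex.norm_real, Real.norm_eq_abs]
      have h4 : ‖resolvent S l * resolvent S m‖ ≤ K * ‖resolvent S m‖ :=
        (norm_mul_le _ _).trans (mul_le_mul_of_nonneg_right (hK l hl) (norm_nonneg _))
      have h5 : |l.re| * ‖resolvent S l * resolvent S m‖ ≤ h * (K * ‖resolvent S m‖) := by
        gcongr
      linarith
    have h6 : 1 / |l.im| ^ b ≤ (2 : ℝ) ^ b * (1 + |l.im|) ^ (-b) := by
      rw [Real.rpow_neg (by positivity), ← div_eq_mul_inv, div_le_div_iff₀ (by positivity)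
        (by positivity), one_mul, ← Real.mul_rpow (by positivity) (by positivity)]
      exact Real.rpow_le_rpow (by positivity) (by linarith) b0.le
    calc ‖resolvent S l‖ ≤ (1 + h * K) * (M / |l.im| ^ b) := h2.trans (by gcongr)
      _ = (M * (1 + h * K)) * (1 / |l.im| ^ b) := by ring
      _ ≤ (K + M * (1 + h * K)) * (1 / |l.im| ^ b) := by
        gcongr; linarith
      _ ≤ _ := by gcongr

lemma APlus_eq_lineInt (S : X →ₗ.[ℂ] X) (h : ℝ) :
    APlus S h = lineInt (resolvent S) h fun l => (l⁻¹) ^ 2 := by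
  have hI : Complex.I ≠ 0 := Complex.I_ne_zero
  have hpi : (Real.pi : ℂ) ≠ 0 := by exact_mod_cast Real.pi_ne_zero
  rw [APlus, lineIntegral, lineInt, ← integral_smul, ← integral_smul]
  refine integral_congr_ae (Eventually.of_forall fun t => ?_)
  simp only [smul_smul]
  congr 1
  rw [vline, one_div, one_div, ← inv_pow]
  field_simp

/-- The substitution $t\mapsto-t$ exhibits $A_-$ as the operator $A_+$ of $-S$. -/
lemma AMinus_eq_lineInt (S : X →ₗ.[ℂ] X) (h : ℝ) :
    AMinus S h = lineInt (fun l => -resolvent S (-l)) h fun l => (l⁻¹) ^ 2 := by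
  have hI : Complex.I ≠ 0 := Complex.I_ne_zero
  have hpi : (Real.pi : ℂ) ≠ 0 := by exact_mod_cast Real.pi_ne_zero
  rw [AMinus, lineIntegral, lineInt, ← integral_smul, ← integral_smul, ← integral_neg,
    ← integral_neg_eq_self]
  refine integral_congr_ae (Eventually.of_forall fun t => ?_)
  have e : ((-h : ℝ) : ℂ) + ((-t : ℝ) : ℂ) * Complex.I = -vline h t := by
    simp only [vline]; push_cast; ring
  simp only [e, smul_neg, smul_smul]
  congr 2
  rw [neg_sq, one_div, one_div, ← inv_pow]
  field_simp

/-- Reduces domain membership and values of the unbounded $S^2A$ to an identity between bounded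
operators. -/
lemma exists_opComp_opComp_ofBounded_eq {S : X →ₗ.[ℂ] X} {A R : X →L[ℂ] X}
    (hR : IsResolventAt S 0 R) {x w : X} (hx : A x = R (R w)) :
    ∃ hd : x ∈ (opComp (opComp S S) (ofBounded A)).domain,
      opComp (opComp S S) (ofBounded A) ⟨x, hd⟩ = w := by
  have h1 : A x ∈ S.domain := hx ▸ hR.mem_domain _
  have h2 : S ⟨A x, h1⟩ = R w := by
    rw [← hR.apply_zero (R w)]
    congr 1
    exact Subtype.ext hx
  have h3 : S ⟨A x, h1⟩ ∈ S.domain := h2 ▸ hR.mem_domain _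
  refine ⟨⟨Submodule.mem_top, h1, h3⟩, ?_⟩
  change S ⟨S ⟨A x, h1⟩, h3⟩ = w
  rw [← hR.apply_zero w]
  congr 1
  exact Subtype.ext h2

/-! ### Spectral decomposition -/

/-- Splitting off the spectrum in the right half plane: if `P₊ = S² A₊` is bounded then
`(S - z)⁻¹ P₊` extends boundedly to the closed left half plane. -/
lemma DecayingPseudoResolvent.exists_halfPlane_extension [CompleteSpace X] {R : ℂ → X →L[ℂ] X}
    {h C b : ℝ} (hR : DecayingPseudoResolvent R h C b) (inj : Function.Injective (R 0))
    {P : X →L[ℂ] X} (hP : R 0 * (R 0 * P) = lineInt R h fun l => (l⁻¹) ^ 2)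
    (hPc : ∀ l : ℂ, |l.re| ≤ h → Commute P (R l)) :
    ∃ (H : ℂ → X →L[ℂ] X) (K : ℝ), ∀ z : ℂ, z.re ≤ 0 →
      H z = z • (R 0 * H z) + R 0 * P ∧ Commute (R 0) (H z) ∧ Commute P (H z) ∧ ‖H z‖ ≤ K := by
  have hB : lineInt R h (fun l => l⁻¹) = R 0 * P := by
    have h1 := hR.zero_mul_lineInt_inv.trans hP.symm
    ext y
    exact inj (congrArg (fun T : X →L[ℂ] X => T y) h1)
  obtain ⟨K, hK⟩ := hR.exists_norm_lineInt_inv_sub_le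
  have hl : ∀ t, |(vline h t).re| ≤ h := fun t => by simp [abs_of_pos hR.h_pos]
  refine ⟨fun z => lineInt R h fun l => (l - z)⁻¹, K, fun z hz => ⟨?_, ?_, ?_, hK z hz⟩⟩
  · rw [← hB]
    exact hR.lineInt_inv_sub_eq hz
  · exact commute_lineInt (hR.integrable_inv_sub_smul hz) fun t =>
      hR.commute (by simpa using hR.h_pos.le) (hl t)
  · exact commute_lineInt (hR.integrable_inv_sub_smul hz) fun t => hPc _ (hl t)

/-- `hH` says $(S-z)H=Q$, and `Q` is the identity on `U`; commutation with `R` turns the right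
inverse into a left inverse. -/
lemma exists_isResolventAt_restrict {S : X →ₗ.[ℂ] X} {R Q H : X →L[ℂ] X} {z : ℂ}
    (hR : IsResolventAt S 0 R) {U : Submodule ℂ X} (hU : IsInvariant S U)
    (hQ : ∀ x, x ∈ U ↔ Q x = x) (hH : H = z • (R * H) + R * Q)
    (hRH : Commute R H) (hRQ : Commute R Q) (hQH : Commute Q H) :
    ∃ T : U →L[ℂ] U, IsResolventAt (restrict S U hU) z T ∧ ‖T‖ ≤ ‖H‖ := by
  have app : ∀ {T V : X →L[ℂ] X}, Commute T V → ∀ y, T (V y) = V (T y) := fun hc y =>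
    congrArg (fun T : X →L[ℂ] X => T y) hc.eq
  have mem : ∀ x : U, H x ∈ U := fun x => by
    rw [hQ, app hQH, (hQ x).1 x.2]
  have hH' : ∀ y, H y = R (z • H y + Q y) := fun y => by
    have := congrArg (fun T : X →L[ℂ] X => T y) hH
    simpa using this
  refine ⟨(H.comp U.subtypeL).codRestrict U mem, ⟨fun y => ?_, fun x => ?_⟩, ?_⟩
  · have hd : H y ∈ S.domain := (hH' y).symm ▸ hR.mem_domain _
    refine ⟨hd, Subtype.ext ?_⟩
    change S ⟨H y, hd⟩ - z • H y = y
    have e : S ⟨H y, hd⟩ = z • H y + Q y := by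
      rw [← hR.apply_zero (z • H y + Q y)]
      congr 1
      exact Subtype.ext (hH' y)
    rw [e, add_sub_cancel_left, (hQ y).1 y.2]
  · refine Subtype.ext ?_
    have hx : (x.1.1 : X) ∈ S.domain := x.2
    change H (S ⟨x.1.1, hx⟩ - z • x.1.1) = x.1.1
    have e : R (S ⟨x.1.1, hx⟩) = x.1.1 := hR.zero_apply ⟨x.1.1, hx⟩
    set y := S ⟨x.1.1, hx⟩ with hy
    have h1 : H x.1.1 = R (H y) := by rw [← e, app hRH]
    rw [map_sub, map_smul, h1]
    nth_rewrite 1 [hH' y]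
    rw [map_add, map_smul, add_sub_cancel_left, app hRQ, e]
    exact (hQ _).1 x.1.2
  · refine ContinuousLinearMap.opNorm_le_bound _ (norm_nonneg _) fun y => ?_
    exact H.le_opNorm (y : X)

lemma isInvariant_of_commute {S : X →ₗ.[ℂ] X} {R Q : X →L[ℂ] X} (hR : IsResolventAt S 0 R)
    {U : Submodule ℂ X} (hQ : ∀ x, x ∈ U ↔ Q x = x) (hRQ : Commute R Q) : IsInvariant S U := by
  intro x hx
  rw [hQ] at hx ⊢
  refine hR.injective ?_
  have : R (Q (S x)) = Q (R (S x)) := congrArg (fun T : X →L[ℂ] X => T (S x)) hRQ.eq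
  rw [this, hR.zero_apply, hx]

/-- The decomposition is $X_+=\ker(1-P)$, $X_-=\ker P$. Injectivity of $R(0)$ lets all identities
for `P` be checked after multiplication by powers of $R(0)$. -/
theorem strictlyDichotomous_of_bounded [CompleteSpace X] {S : X →ₗ.[ℂ] X} {h C b : ℝ}
    (hh : BoundedOnStrip S h) (hR : DecayingPseudoResolvent (resolvent S) h C b) {P : X →L[ℂ] X}
    (hP : resolvent S 0 * (resolvent S 0 * P) = APlus S h) : StrictlyDichotomous S := by
  have abs0 : |(0 : ℂ).re| ≤ h := by simpa using hR.h_pos.le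
  have h0 : IsResolventAt S 0 (resolvent S 0) := isResolventAt_resolvent (hh.2.1 0 abs0)
  set R := resolvent S with hRdef
  have inj := h0.injective
  have cancel : ∀ {T V : X →L[ℂ] X}, R 0 * T = R 0 * V → T = V := fun hTV => by
    ext y
    exact inj (congrArg (fun T : X →L[ℂ] X => T y) hTV)
  rw [APlus_eq_lineInt] at hP
  have hB : lineInt R h (fun l => l⁻¹) = R 0 * P := cancel (hR.zero_mul_lineInt_inv.trans hP.symm)
  have hB' : lineInt (fun l => -R (-l)) h (fun l => l⁻¹) = -(R 0 * (1 - P)) := by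
    ext y
    have h1 := hR.lineInt_sub_lineInt_reflect y
    rw [hB, sub_eq_iff_eq_add, ← sub_eq_iff_eq_add'] at h1
    rw [← h1]
    simp
  have hA' : lineInt (fun l => -R (-l)) h (fun l => (l⁻¹) ^ 2) = R 0 * (R 0 * (1 - P)) := by
    rw [← hR.reflect.zero_mul_lineInt_inv, hB', neg_zero, neg_mul_neg]
  have hPc : ∀ l : ℂ, |l.re| ≤ h → Commute P (R l) := fun l hl => by
    have c0 : Commute (R l) (R 0) := hR.commute hl abs0
    have c1 : Commute (R l) (R 0 * P) := by
      rw [← hB]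
      exact commute_lineInt hR.integrable_inv fun t =>
        hR.commute hl (by simp [abs_of_pos hR.h_pos])
    refine cancel ?_
    rw [← mul_assoc, ← c1.eq, ← mul_assoc, ← mul_assoc, c0.eq]
  -- With $A_-=R(0)^2(1-P)$ and $B=R(0)P$, the relation $A_-B=0$ reads $R(0)^3(1-P)P=0$.
  have idem : (1 - P) * P = 0 := by
    have h1 := hR.lineInt_reflect_mul_lineInt
    rw [hA', hB] at h1
    have c0 : Commute (R 0) (1 - P) :=
      (Commute.one_right _).sub_right (hPc 0 abs0).symm
    refine cancel (cancel (cancel ?_))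
    rw [mul_zero, mul_zero, mul_zero, ← h1]
    simp only [mul_assoc]
    rw [← mul_assoc (R 0) (1 - P) P, c0.eq, mul_assoc]
  have idem' : ∀ y, P (P y) = P y := fun y => by
    have := congrArg (fun T : X →L[ℂ] X => T y) idem
    simp only [mul_apply_eq_comp, sub_apply, one_apply_eq_self, zero_apply,
      sub_eq_zero] at this
    exact this.symm
  have cP : Commute (R 0) P := (hPc 0 abs0).symm
  have cQ : Commute (R 0) (1 - P) := (Commute.one_right _).sub_right cP
  have memp : ∀ x, x ∈ (LinearMap.ker ((1 - P : X →L[ℂ] X) : X →ₗ[ℂ] X)) ↔ P x = x := fun x => by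
    change x - P x = 0 ↔ P x = x
    rw [sub_eq_zero, eq_comm]
  have memm : ∀ x, x ∈ (LinearMap.ker (P : X →ₗ[ℂ] X)) ↔ (1 - P) x = x := fun x => by
    simp
  have invp := isInvariant_of_commute h0 memp cP
  have invm := isInvariant_of_commute h0 memm cQ
  obtain ⟨H, K, hH⟩ := hR.exists_halfPlane_extension inj hP hPc
  have hP' : -R (-0) * (-R (-0) * (1 - P)) = lineInt (fun l => -R (-l)) h fun l => (l⁻¹) ^ 2 := by
    rw [hA', neg_zero]; simp only [neg_mul, mul_neg, neg_neg]
  obtain ⟨H', K', hH'⟩ := hR.reflect.exists_halfPlane_extension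
    (by rw [neg_zero]; exact neg_injective.comp inj) hP' (fun l hl =>
      ((Commute.one_left _).sub_left (hPc (-l) (by simpa using hl))).neg_right)
  have resp : ∀ z : ℂ, z.re ≤ 0 → ∃ T, IsResolventAt (restrict S _ invp) z T ∧ ‖T‖ ≤ K :=
    fun z hz => by
      obtain ⟨e, c1, c2, c3⟩ := hH z hz
      obtain ⟨T, h1, h2⟩ := exists_isResolventAt_restrict h0 invp memp e c1 cP c2
      exact ⟨T, h1, h2.trans c3⟩
  have resm : ∀ z : ℂ, 0 ≤ z.re → ∃ T, IsResolventAt (restrict S _ invm) z T ∧ ‖T‖ ≤ K' :=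
    fun z hz => by
      obtain ⟨e, c1, c2, c3⟩ := hH' (-z) (by simpa using hz)
      rw [neg_zero] at e c1
      -- The resolvent of $S$ at $z$ is minus that of $-S$ at $-z$.
      have e' : -H' (-z) = z • (R 0 * -H' (-z)) + R 0 * (1 - P) := by
        nth_rewrite 1 [e]
        simp only [neg_mul, mul_neg, smul_neg, neg_smul, neg_neg, neg_add]
      obtain ⟨T, h1, h2⟩ := exists_isResolventAt_restrict h0 invm memm e'
        (Commute.neg_left_iff.1 c1).neg_right cQ c2.neg_right
      exact ⟨T, h1, h2.trans (by rwa [norm_neg])⟩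
  refine ⟨_, _, ⟨?_, ?_, ?_, fun l hl => hh.2.1 l (by rw [hl]; simpa using hR.h_pos.le), invp, invm,
    ?_, ?_, ⟨K, fun z hz => ?_⟩, ⟨K', fun z hz => ?_⟩⟩⟩
  · exact (1 - P).isClosed_ker
  · exact P.isClosed_ker
  · refine IsCompl.of_eq ?_ ?_
    · rw [eq_bot_iff]
      rintro x ⟨hx1, hx2⟩
      have h1 := (memp x).1 hx1
      have h2 : P x = 0 := hx2
      rw [Submodule.mem_bot, ← h1, h2]
    · rw [eq_top_iff]
      intro x _
      refine Submodule.mem_sup.2 ⟨P x, (memp _).2 (idem' x), x - P x, ?_, by abel⟩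
      change P (x - P x) = 0
      rw [map_sub, idem', sub_self]
  · intro z hz
    by_contra hneg
    obtain ⟨T, hT, -⟩ := resp z (not_lt.1 hneg)
    exact hz ⟨T, hT⟩
  · intro z hz
    by_contra hneg
    obtain ⟨T, hT, -⟩ := resm z (not_lt.1 hneg)
    exact hz ⟨T, hT⟩
  · obtain ⟨T, hT, hn⟩ := resp z hz
    rwa [hT.resolvent_eq]
  · obtain ⟨T, hT, hn⟩ := resm z hz
    rwa [hT.resolvent_eq]

/-! ### The projections on the domain -/

section Projections

variable [CompleteSpace X] {S : X →ₗ.[ℂ] X} {h C b : ℝ}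

lemma APlus_resolvent_zero_apply (hR : DecayingPseudoResolvent (resolvent S) h C b) (y : X) :
    APlus S h (resolvent S 0 y)
      = resolvent S 0 (resolvent S 0 (lineInt (resolvent S) h (fun l => l⁻¹) y)) := by
  have abs0 : |(0 : ℂ).re| ≤ h := by simpa using hR.h_pos.le
  have c : Commute (resolvent S 0) (lineInt (resolvent S) h fun l => l⁻¹) :=
    commute_lineInt hR.integrable_inv fun t => hR.commute abs0 (by simp [abs_of_pos hR.h_pos])
  rw [APlus_eq_lineInt, ← hR.zero_mul_lineInt_inv]
  exact congrArg (fun T : X →L[ℂ] X => resolvent S 0 (T y)) c.eq.symm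

lemma AMinus_resolvent_zero_apply (hR : DecayingPseudoResolvent (resolvent S) h C b) (y : X) :
    AMinus S h (resolvent S 0 y)
      = resolvent S 0 (resolvent S 0
        (-lineInt (fun l => -resolvent S (-l)) h (fun l => l⁻¹) y)) := by
  have abs0 : |(0 : ℂ).re| ≤ h := by simpa using hR.h_pos.le
  have c : Commute (resolvent S 0) (lineInt (fun l => -resolvent S (-l)) h fun l => l⁻¹) :=
    commute_lineInt hR.reflect.integrable_inv fun t =>
      (hR.commute abs0 (by simp [abs_of_pos hR.h_pos])).neg_right
  rw [AMinus_eq_lineInt, ← hR.reflect.zero_mul_lineInt_inv, neg_zero, neg_mul, neg_apply,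
    map_neg, map_neg]
  exact congrArg (fun T : X →L[ℂ] X => -resolvent S 0 (T y)) c.eq.symm

lemma hasPVIntegral_resolvent (hR : DecayingPseudoResolvent (resolvent S) h C b) (y : X) :
    HasPVIntegral (fun l => resolvent S l (resolvent S 0 y))
      (((Real.pi : ℂ) * Complex.I) •
        ((2 : ℂ) • lineInt (resolvent S) h (fun l => l⁻¹) y - resolvent S 0 y)) := by
  have hc : Continuous fun t : ℝ => resolvent S ((t : ℂ) * Complex.I) (resolvent S 0 y) := by
    have := hR.continuous_vline (c := 0) (by simpa using hR.h_pos.le)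
    simp only [vline_zero] at this
    exact this.clm_apply continuous_const
  refine ⟨fun r => (hc.const_smul Complex.I).intervalIntegrable _ _, ?_⟩
  have lim := (hR.tendsto_integral_imaginary_axis y).const_smul Complex.I
  simp only [vline_zero] at lim
  simp only [intervalIntegral.integral_smul]
  convert lim using 2
  simp only [smul_sub, smul_smul]
  congr 2 <;> ring

end Projections

end Dichotomy

end

/-! ### The main theorem. -/

theorem corollary5p8 {X : Type*} [NormedAddCommGroup X] [NormedSpace ℂ X] [CompleteSpace X]
    (S : X →ₗ.[ℂ] X) (hS : Dichotomy.AlmostBisectorial S) :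
    (∃ h : ℝ, Dichotomy.BoundedOnStrip S h) ∧
    ∀ h : ℝ, Dichotomy.BoundedOnStrip S h →
      (∀ x : X, x ∈ S.domain →
        ∃ (hp : x ∈ (Dichotomy.PPlus S h).domain) (hm : x ∈ (Dichotomy.PMinus S h).domain),
          (2 : ℂ) • Dichotomy.PPlus S h ⟨x, hp⟩ - x
              = Dichotomy.PPlus S h ⟨x, hp⟩ - Dichotomy.PMinus S h ⟨x, hm⟩ ∧
          ∃ v : X, Dichotomy.HasPVIntegral (fun l : ℂ => Dichotomy.resolvent S l x) v ∧
            Dichotomy.PPlus S h ⟨x, hp⟩ - Dichotomy.PMinus S h ⟨x, hm⟩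
              = (1 / ((Real.pi : ℂ) * Complex.I)) • v) ∧
      (Dense (S.domain : Set X) →
        (∃ D : Submodule ℂ X, D ≤ S.domain ∧ (S.domain : Set X) ⊆ closure (D : Set X) ∧
          ∃ T : D →L[ℂ] X, ∀ x : D,
            Dichotomy.HasPVIntegral (fun l : ℂ => Dichotomy.resolvent S l (x : X)) (T x)) →
        ((Dichotomy.PPlus S h).domain = ⊤ ∧
          ∃ C : ℝ, ∀ x : (Dichotomy.PPlus S h).domain, ‖Dichotomy.PPlus S h x‖ ≤ C * ‖(x : X)‖) ∧
        Dichotomy.StrictlyDichotomous S) := by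
  refine ⟨hS.exists_boundedOnStrip, fun h hh => ?_⟩
  obtain ⟨C, b, hR⟩ := hS.exists_decayingPseudoResolvent hh
  have pi0 : (Real.pi : ℂ) * Complex.I ≠ 0 := by simp [Real.pi_ne_zero]
  have h0 : Dichotomy.IsResolventAt S 0 (Dichotomy.resolvent S 0) :=
    Dichotomy.isResolventAt_resolvent (hh.2.1 0 (by simpa using hR.h_pos.le))
  refine ⟨fun x hx => ?_, fun hdense => ?_⟩
  · set y := S ⟨x, hx⟩ with hy
    have hxy : Dichotomy.resolvent S 0 y = x := h0.zero_apply ⟨x, hx⟩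
    obtain ⟨hp, ep⟩ := Dichotomy.exists_opComp_opComp_ofBounded_eq h0
      (hxy ▸ Dichotomy.APlus_resolvent_zero_apply hR y)
    obtain ⟨hm, em⟩ := Dichotomy.exists_opComp_opComp_ofBounded_eq h0
      (hxy ▸ Dichotomy.AMinus_resolvent_zero_apply hR y)
    change Dichotomy.PPlus S h ⟨x, hp⟩ = _ at ep
    change Dichotomy.PMinus S h ⟨x, hm⟩ = _ at em
    have hres := hR.lineInt_sub_lineInt_reflect y
    have hpv := Dichotomy.hasPVIntegral_resolvent hR y
    rw [hxy] at hres hpv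
    have key : (2 : ℂ) • Dichotomy.PPlus S h ⟨x, hp⟩ - x
        = Dichotomy.PPlus S h ⟨x, hp⟩ - Dichotomy.PMinus S h ⟨x, hm⟩ := by
      rw [ep, em, two_smul, ← hres]
      abel
    refine ⟨hp, hm, key, _, hpv, ?_⟩
    rw [← key, smul_smul, one_div, inv_mul_cancel₀ pi0, one_smul, ep]
  · rintro ⟨D, hD, hDd, T, hT⟩
    have dense : DenseRange D.subtypeL := by
      have : Dense (D : Set X) := fun x =>
        closure_minimal hDd isClosed_closure (hdense x)
      simpa [DenseRange] using this
    -- Solves $2P_+x-x=\frac1{\pi i}Tx$ for $P_+$, with `T` extended continuously from the dense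
    -- `D`.
    set P : X →L[ℂ] X := (2⁻¹ : ℂ) • (1 + ((Real.pi : ℂ) * Complex.I)⁻¹ • T.extend D.subtypeL)
      with hPdef
    have hP : Dichotomy.resolvent S 0 * (Dichotomy.resolvent S 0 * P) = Dichotomy.APlus S h := by
      refine ContinuousLinearMap.coeFn_injective (dense.equalizer (map_continuous _)
        (map_continuous _) (funext fun x => ?_))
      have ext : T.extend D.subtypeL (D.subtypeL x) = T x :=
        T.extend_eq dense isUniformEmbedding_subtype_val.isUniformInducing x
      set y := S ⟨x, hD x.2⟩ with hy
      have hxy : Dichotomy.resolvent S 0 y = x := h0.zero_apply ⟨x, hD x.2⟩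
      have hpv := Dichotomy.hasPVIntegral_resolvent hR y
      rw [hxy] at hpv
      -- Uniqueness of the principal value identifies `T x` with the value computed from the contour
      -- integral.
      have hTx := tendsto_nhds_unique (hT x).2 hpv.2
      have hPx : P (D.subtypeL x)
          = Dichotomy.lineInt (Dichotomy.resolvent S) h (fun l => l⁻¹) y := by
        rw [hPdef, smul_apply, add_apply, smul_apply, ext, hTx, smul_smul, inv_mul_cancel₀ pi0,
          one_smul, one_apply_eq_self, Submodule.subtypeL_apply, add_sub_cancel,
          smul_smul, inv_mul_cancel₀ two_ne_zero, one_smul]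
      have hA := Dichotomy.APlus_resolvent_zero_apply hR y
      rw [hxy, ← hPx] at hA
      exact hA.symm
    have hPP : ∀ x : X, ∃ hd : x ∈ (Dichotomy.PPlus S h).domain,
        Dichotomy.PPlus S h ⟨x, hd⟩ = P x := fun x =>
      Dichotomy.exists_opComp_opComp_ofBounded_eq h0
        (congrArg (fun A : X →L[ℂ] X => A x) hP).symm
    refine ⟨⟨eq_top_iff.2 fun x _ => (hPP x).1, ‖P‖, fun x => ?_⟩,
      Dichotomy.strictlyDichotomous_of_bounded hh hR hP⟩
    obtain ⟨_, e⟩ := hPP x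
    rw [e]
    exact P.le_opNorm _
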